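/- Let $\mathcal Y$ be a finite set and $\mathcal P(\mathcal Y)$ the set of probability mass functions (pmfs) on it. For pmfs $p,q$ put $B(p,q)=-\log\sum_y p(y)^{1/2}q(y)^{1/2}$, $C(p,q)=\max_{s\in[0,1]}-\log\sum_y p(y)^sq(y)^{1-s}$, $D(p\|q)=\sum_y p(y)\log\frac{p(y)}{q(y)}$, and $C_\pi=-\log\min_y\pi(y)$. Fix an integer $T>1$. For $M>2T$, pmfs $\mu_1,\dots,\mu_M,\pi$ on $\mathcal Y$ with full support and $\mu_i\ne\pi$ for all $i$, and a set $S\subset\{1,\dots,M\}$ with $|S|=T$, let $p_S$ be the law of $n$ i.i.d. observations of $M$ independent coordinates, where coordinate $i$ has law $\mu_i$ if $i\in S$ and law $\pi$ if $i\notin S$. For a test $\delta$, i.e. a map for each $n$ from data $y^{Mn}\in\mathcal Y^{Mn}$ to $T$-subsets of $\{1,\dots,M\}$, the error exponent is $$\alpha\big(\delta,(\{\mu_i\}_{i=1}^M,\pi)\big)=\lim_{n\to\infty}-\frac1n\log\max_{|S|=T}\ \sum_{y^{Mn}:\,\delta(y^{Mn})\neq S}p_S(y^{Mn}).$$ Let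 $\gamma_j$ be the empirical distribution of coordinate $j$. The universal test $\delta$ selects a $T$-subset $S$ minimizing $\sum_{j\notin S}D\big(\gamma_j\,\big\|\,\frac{1}{M-T}\sum_{k\notin S}\gamma_k\big)$, with ties broken arbitrarily. It does not depend on $(\{\mu_i\},\pi)$. The test for known $\pi$ selects a $T$-subset $S$ minimizing $\sum_{j\notin S}D(\gamma_j\|\pi)$, with ties broken arbitrarily. Then the following hold. (1) For every $M>2T$ and all such $\mu_1,\dots,\mu_M,\pi$, the error exponent of the universal test exists and is at least $$\min_{q}\ \min_{1\le i\le M}2B(\mu_i,q),$$ where the outer minimum (which is attained) is over all $q\in\mathcal P(\mathcal Y)$ with $$D(q\|\pi)\le\frac1{M-T}\Big(\min_{1\le i<j\le M}C\big(\mu_i(y)\pi(y'),\pi(y)\mu_j(y')\big)+T\,C_\pi\Big).$$ (2) The universal test is universally asymptotically exponentially consistent: for every $\pi$ and every infinite sequence $\mu_1,\mu_2,\dots$ of pmfs with full support and $\mu_i\neq\pi$ (also $\pi$ of full support), if $\min_{1\le i<j\le M}C(\mu_i(y)\pi(y'),\pi(y)\mu_j(y'))$ does not tend to $0$ as $M\to\infty$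 ($T$ fixed), then $\lim_{M\to\infty}\alpha(\delta,(\{\mu_i\}_{i=1}^M,\pi))$ exists and is positive. (3) For every such $\pi$ and $\mu_1,\mu_2,\dots$, both limits below exist and $$\lim_{M\to\infty}\alpha\big(\delta,(\{\mu_i\}_{i=1}^M,\pi)\big)=\lim_{M\to\infty}\min_{1\le i\le M}2B(\mu_i,\pi),$$ and this is also the limit as $M\to\infty$ of the error exponent of the test for known $\pi$. (4) If all $\mu_i=\mu\neq\pi$, the universal test is asymptotically efficient: $\lim_{M\to\infty}\alpha(\delta,(\mu,\pi))=2B(\mu,\pi)$, and no test does better: for every $M>2T$ and every test, even one that may depend on $\mu$ and $\pi$, the upper limit over $n$ of $-\frac1n\log$ of its maximal error probability is at most $2B(\mu,\pi)$. -/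

import Mathlib

open Filter Topology

noncomputable section

namespace OutlierTest

/-- `p` is a probability mass function on the finite alphabet `Y` with full support. -/
def FullPmf {Y : Type*} [Fintype Y] (p : Y → ℝ) : Prop :=
  p ∈ stdSimplex ℝ Y ∧ ∀ y, 0 < p y

/-- The Bhattacharyya distance `B(p, q) = -log ∑ √p(y) √q(y)`.
It is finite as soon as the supports of `p` and `q` meet. -/
def bhatt {Y : Type*} [Fintype Y] (p q : Y → ℝ) : ℝ :=
  -Real.log (∑ y, √(p y) * √(q y))

/-- The Chernoff information `C(p, q) = max_{s ∈ [0,1]} -log ∑ p(y)^s q(y)^(1-s)`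
(used for `p`, `q` with full support, where the maximum is attained). -/
def chernoff {Y : Type*} [Fintype Y] (p q : Y → ℝ) : ℝ :=
  ⨆ s : Set.Icc (0 : ℝ) 1, -Real.log (∑ y, p y ^ (s : ℝ) * q y ^ (1 - (s : ℝ)))

/-- The relative entropy `D(p ‖ q) = ∑ p(y) log (p(y) / q(y))`, with `0 log 0 = 0`.
It is only used where `q y = 0` implies `p y = 0`, so that its value is finite. -/
def relEnt {Y : Type*} [Fintype Y] (p q : Y → ℝ) : ℝ :=
  ∑ y, p y * Real.log (p y / q y)

/-- `C_π = -log (min_y π(y))`. -/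
def cConst {Y : Type*} (π : Y → ℝ) : ℝ :=
  -Real.log (⨅ y, π y)

/-- Data with `M` coordinates and `n` observations: `y i k` is the `k`-th observation of the
`i`-th coordinate. -/
abbrev Data (Y : Type*) (M n : ℕ) : Type _ := Fin M → Fin n → Y

/-- A decision rule for `M` coordinates, at every sample size `n`. -/
abbrev Rule (Y : Type*) (M : ℕ) : Type _ := ∀ n : ℕ, Data Y M n → Finset (Fin M)

/-- The empirical distribution of a sequence. -/
def empirical {Y : Type*} [DecidableEq Y] {n : ℕ} (x : Fin n → Y) (a : Y) : ℝ :=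
  ((Finset.univ.filter fun k => x k = a).card : ℝ) / n

/-- The average of the empirical distributions of the coordinates outside `S`, `|S| = T`. -/
def avgEmpirical {Y : Type*} [DecidableEq Y] {M n : ℕ} (T : ℕ) (y : Data Y M n)
    (S : Finset (Fin M)) (a : Y) : ℝ :=
  (∑ k ∈ Sᶜ, empirical (y k) a) / ((M : ℝ) - T)

/-- The statistic `U_S^univ`, which uses neither the outlier nor the typical distributions. -/
def statUniv {Y : Type*} [Fintype Y] [DecidableEq Y] {M n : ℕ} (T : ℕ) (y : Data Y M n)
    (S : Finset (Fin M)) : ℝ :=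
  ∑ j ∈ Sᶜ, relEnt (empirical (y j)) (avgEmpirical T y S)

/-- The statistic `U_S^typ`, which uses the typical distribution `π`. -/
def statTyp {Y : Type*} [Fintype Y] [DecidableEq Y] {M n : ℕ} (π : Y → ℝ) (y : Data Y M n)
    (S : Finset (Fin M)) : ℝ :=
  ∑ j ∈ Sᶜ, relEnt (empirical (y j)) π

/-- `δ` is the universal test: it always selects a `T`-subset minimizing `U_S^univ`
(ties are broken arbitrarily). -/
def IsUnivTest {Y : Type*} [Fintype Y] [DecidableEq Y] {M : ℕ} (T : ℕ) (δ : Rule Y M) : Prop :=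
  ∀ (n : ℕ) (y : Data Y M n), (δ n y).card = T ∧
    ∀ S : Finset (Fin M), S.card = T → statUniv T y (δ n y) ≤ statUniv T y S

/-- `δ` is the test for known `π`: it always selects a `T`-subset minimizing `U_S^typ`
(ties are broken arbitrarily). -/
def IsTypTest {Y : Type*} [Fintype Y] [DecidableEq Y] {M : ℕ} (T : ℕ) (π : Y → ℝ)
    (δ : Rule Y M) : Prop :=
  ∀ (n : ℕ) (y : Data Y M n), (δ n y).card = T ∧
    ∀ S : Finset (Fin M), S.card = T → statTyp π y (δ n y) ≤ statTyp π y S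

/-- The joint pmf `p_S` of the data when `S` is the set of outlier coordinates. -/
def jointProb {Y : Type*} {M n : ℕ} (μ : Fin M → Y → ℝ) (π : Y → ℝ) (S : Finset (Fin M))
    (y : Data Y M n) : ℝ :=
  ∏ k : Fin n, ((∏ i ∈ S, μ i (y i k)) * ∏ j ∈ Sᶜ, π (y j k))

/-- The maximal error probability `max_{|S| = T} ∑_{y : δ(y) ≠ S} p_S(y)`. -/
def maxError {Y : Type*} [Fintype Y] {M : ℕ} (T : ℕ) (δ : Rule Y M) (μ : Fin M → Y → ℝ)
    (π : Y → ℝ) (n : ℕ) : ℝ :=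
  ⨆ S : {S : Finset (Fin M) // S.card = T},
    ∑ y ∈ (Finset.univ : Finset (Data Y M n)).filter (fun y => δ n y ≠ S.1), jointProb μ π S.1 y

/-- The error exponent of `δ` exists and equals `a`: `lim_n -(1/n) log e = a`. -/
def HasErrorExponent {Y : Type*} [Fintype Y] {M : ℕ} (T : ℕ) (δ : Rule Y M)
    (μ : Fin M → Y → ℝ) (π : Y → ℝ) (a : ℝ) : Prop :=
  Tendsto (fun n : ℕ => -(1 / (n : ℝ)) * Real.log (maxError T δ μ π n)) atTop (𝓝 a)

/-- `min_{i < j} C(μ_i(y) π(y'), π(y) μ_j(y'))`. -/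
def minChernoff {Y : Type*} [Fintype Y] {M : ℕ} (μ : Fin M → Y → ℝ) (π : Y → ℝ) : ℝ :=
  ⨅ p : {p : Fin M × Fin M // p.1 < p.2},
    chernoff (fun z : Y × Y => μ p.1.1 z.1 * π z.2) (fun z : Y × Y => π z.1 * μ p.1.2 z.2)

/-- `min_i 2 B(μ_i, q)`. -/
def minBhatt {Y : Type*} [Fintype Y] {M : ℕ} (μ : Fin M → Y → ℝ) (q : Y → ℝ) : ℝ :=
  ⨅ i : Fin M, 2 * bhatt (μ i) q

/-- The first `M` members of an infinite sequence of outlier distributions. -/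
def firstM {Y : Type*} (μ : ℕ → Y → ℝ) (M : ℕ) : Fin M → Y → ℝ := fun i => μ i

/-- Universally asymptotically exponential consistency of a family of tests (one for each
number of coordinates `M > 2T`): the limit in `M` of the error exponents exists and is positive,
unless the optimal error exponents for known distributions tend to zero. -/
def UnivAsympExpConsistent {Y : Type*} [Fintype Y] (T : ℕ) (δ : ∀ M : ℕ, Rule Y M) : Prop :=
  ∀ (μ : ℕ → Y → ℝ) (π : Y → ℝ), (∀ i, FullPmf (μ i)) → FullPmf π → (∀ i, μ i ≠ π) →
    ¬ Tendsto (fun M : ℕ => minChernoff (firstM μ M) π) atTop (𝓝 0) →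
    ∃ (α : ℕ → ℝ) (L : ℝ),
      (∀ M, 2 * T < M → HasErrorExponent T (δ M) (firstM μ M) π (α M)) ∧
      Tendsto α atTop (𝓝 L) ∧ 0 < L

end OutlierTest

end

open OutlierTest

/-! By the method of types, data with empirical laws γ have probability about `exp (-n * cost)` when
`S` is true, where the cost is the sum of the divergences of the γ_i from the true laws. Hence the
exponent of the universal test is the least cost over `Confusable` triples (S, S', γ), those at
which the statistic of S' is at most that of S (`exists_hasErrorExponent_univ`). Ties do no harm,
because a small perturbation makes a weak preference strict (`exists_jsd_lt_near`).

Let q be the average of γ outside S' and take i in S but not in S'. Replacing π by the average can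
only lower a sum of divergences, so the cost is at least D(γ_i‖μ_i) + D(γ_i‖q), hence at least
2B(μ_i, q) (`two_bhatt_le`). The compensation identity bounds (M - T) D(q‖π) by the cost plus T C_π,
and a converse valid for every test bounds the least cost by the least Chernoff information.
Together these are `Confusable.bound` and `HasErrorExponent.le_minChernoff`.

As M grows, D(q‖π) is O(1/M), so q tends to π and the lower bound approaches the least 2B(μ_i, π),
uniformly in the outlier laws (`bhatt_sub_le`). The matching upper bound puts the normalized
geometric mean of μ_i and π on two coordinates, which ties two sets. If the infimum of B(μ_i, π) is
zero, two distinct outlier laws are close to π and their Chernoff information is small, whence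
consistency. -/

namespace OutlierTest

/-! ### Relative entropy, averages and the Bhattacharyya distance. -/

section relEnt

variable {Y : Type*}

/-- The average of a family over a finite set of indices. -/
noncomputable def avgOn {ι : Type*} (A : Finset ι) (γ : ι → Y → ℝ) (a : Y) : ℝ :=
  (∑ k ∈ A, γ k a) / A.card

theorem avgOn_ac_of_ac {ι : Type*} {A : Finset ι} {γ : ι → Y → ℝ} {r : Y → ℝ} (h : ∀ i ∈ A, ∀ a, r a = 0 → γ i a = 0) :
    ∀ a, r a = 0 → avgOn A γ a = 0 := by
  intro a ha
  rw [avgOn, Finset.sum_eq_zero fun i hi => h i hi a ha, zero_div]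

theorem card_mul_avgOn {ι : Type*} {A : Finset ι} {γ : ι → Y → ℝ} (hA : A.Nonempty) (a : Y) :
    A.card * avgOn A γ a = ∑ k ∈ A, γ k a :=
  mul_div_cancel₀ _ (by exact_mod_cast hA.card_pos.ne')

variable [Fintype Y]

theorem FullPmf.mem {p : Y → ℝ} (h : FullPmf p) : p ∈ stdSimplex ℝ Y := h.1

theorem FullPmf.pos {p : Y → ℝ} (h : FullPmf p) (y : Y) : 0 < p y := h.2 y

/-- The negative Shannon entropy. -/
noncomputable def negEnt (q : Y → ℝ) : ℝ := ∑ a, q a * Real.log (q a)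

theorem continuous_negEnt : Continuous (negEnt : (Y → ℝ) → ℝ) :=
  continuous_finsetSum _ fun a _ => Real.continuous_mul_log.comp (continuous_apply a)

theorem relEnt_eq {q p : Y → ℝ} (h : ∀ a, p a = 0 → q a = 0) :
    relEnt q p = negEnt q - ∑ a, q a * Real.log (p a) := by
  rw [relEnt, negEnt, ← Finset.sum_sub_distrib]
  refine Finset.sum_congr rfl fun a _ => ?_
  by_cases hq : q a = 0
  · simp [hq]
  · rw [Real.log_div hq fun hp => hq (h a hp)]; ring

theorem FullPmf.ac {p : Y → ℝ} (h : FullPmf p) (q : Y → ℝ) : ∀ a, p a = 0 → q a = 0 :=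
  fun a ha => absurd ha (h.pos a).ne'

theorem continuous_relEnt {p : Y → ℝ} (hp : FullPmf p) : Continuous fun q => relEnt q p := by
  simp_rw [fun q => relEnt_eq (hp.ac q)]
  exact continuous_negEnt.sub (by fun_prop)

/-- The relative entropy dominates the squared Hellinger distance. -/
theorem hellinger_le_relEnt {q p : Y → ℝ} (hq : q ∈ stdSimplex ℝ Y) (hp : p ∈ stdSimplex ℝ Y)
    (h : ∀ a, p a = 0 → q a = 0) : ∑ a, (√(q a) - √(p a)) ^ 2 ≤ relEnt q p := by
  -- The left side is 2q - 2√(pq), so this is log x ≤ x - 1 at x = √(p/q); the extra terms q - p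
  -- cancel on summation.
  have key : ∀ a, (√(q a) - √(p a)) ^ 2 + q a - p a ≤ q a * Real.log (q a / p a) := by
    intro a
    rcases (hq.1 a).eq_or_lt with h0 | h0
    · simp [← h0, Real.sq_sqrt (hp.1 a)]
    · have hpa : 0 < p a := (hp.1 a).lt_of_ne fun e => h0.ne' (h a e.symm)
      have h1 := Real.sqrt_pos.2 h0
      have h2 := Real.sqrt_pos.2 hpa
      have hl := Real.log_le_sub_one_of_pos (div_pos h2 h1)
      have e : Real.log (q a / p a) = -2 * Real.log (√(p a) / √(q a)) := by
        rw [Real.log_div h0.ne' hpa.ne', Real.log_div h2.ne' h1.ne', Real.log_sqrt h0.le,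
          Real.log_sqrt hpa.le]
        ring
      have s1 := Real.sq_sqrt h0.le
      have s2 := Real.sq_sqrt hpa.le
      have e2 : q a * (√(p a) / √(q a)) = √(p a) * √(q a) := by
        nth_rewrite 1 [← s1]
        field_simp
      rw [e]
      have := mul_le_mul_of_nonneg_left hl h0.le
      nlinarith
  have := Finset.sum_le_sum fun a (_ : a ∈ Finset.univ) => key a
  simpa [relEnt, Finset.sum_sub_distrib, Finset.sum_add_distrib, hq.2, hp.2] using this

theorem relEnt_nonneg {q p : Y → ℝ} (hq : q ∈ stdSimplex ℝ Y) (hp : p ∈ stdSimplex ℝ Y)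
    (h : ∀ a, p a = 0 → q a = 0) : 0 ≤ relEnt q p :=
  (Finset.sum_nonneg fun _ _ => sq_nonneg _).trans (hellinger_le_relEnt hq hp h)

theorem relEnt_pos {q p : Y → ℝ} (hq : q ∈ stdSimplex ℝ Y) (hp : p ∈ stdSimplex ℝ Y)
    (h : ∀ a, p a = 0 → q a = 0) (hne : q ≠ p) : 0 < relEnt q p := by
  obtain ⟨a, ha⟩ := Function.ne_iff.1 hne
  refine lt_of_lt_of_le ?_ (hellinger_le_relEnt hq hp h)
  refine Finset.sum_pos' (fun _ _ => sq_nonneg _) ⟨a, Finset.mem_univ a, ?_⟩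
  exact sq_pos_of_ne_zero (sub_ne_zero.2 fun e => ha ((Real.sqrt_inj (hq.1 a) (hp.1 a)).1 e))

theorem relEnt_self (q : Y → ℝ) : relEnt q q = 0 := by
  refine Finset.sum_eq_zero fun a _ => ?_
  by_cases h : q a = 0 <;> simp [h]

theorem le_cConst {p : Y → ℝ} (hp : FullPmf p) (a : Y) : -Real.log (p a) ≤ cConst p := by
  have : Nonempty Y := ⟨a⟩
  obtain ⟨b, hb⟩ := exists_eq_ciInf_of_finite (f := p)
  refine neg_le_neg (Real.log_le_log ?_ (ciInf_le (Set.finite_range p).bddBelow a))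
  rw [← hb]
  exact hp.pos b

theorem nonempty_of_pmf {p : Y → ℝ} (hp : p ∈ stdSimplex ℝ Y) : Nonempty Y := by
  by_contra h
  rw [not_nonempty_iff] at h
  simpa using hp.2

theorem pmf_le_one {p : Y → ℝ} (hp : p ∈ stdSimplex ℝ Y) (a : Y) : p a ≤ 1 :=
  hp.2 ▸ Finset.single_le_sum (fun b _ => hp.1 b) (Finset.mem_univ a)

theorem cConst_nonneg {p : Y → ℝ} (hp : FullPmf p) : 0 ≤ cConst p := by
  obtain ⟨a⟩ := nonempty_of_pmf hp.mem
  exact (neg_nonneg.2 (Real.log_nonpos (hp.pos a).le (pmf_le_one hp.mem a))).trans (le_cConst hp a)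

theorem relEnt_le_cConst {q p : Y → ℝ} (hq : q ∈ stdSimplex ℝ Y) (hp : FullPmf p) :
    relEnt q p ≤ cConst p := by
  have key : ∀ a, q a * Real.log (q a / p a) ≤ q a * cConst p := by
    intro a
    rcases (hq.1 a).eq_or_lt with h0 | h0
    · simp [← h0]
    · refine mul_le_mul_of_nonneg_left ?_ h0.le
      rw [Real.log_div h0.ne' (hp.pos a).ne']
      have := Real.log_nonpos h0.le (pmf_le_one hq a)
      have := le_cConst hp a
      linarith
  calc relEnt q p ≤ ∑ a, q a * cConst p := Finset.sum_le_sum fun a _ => key a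
    _ = cConst p := by rw [← Finset.sum_mul, hq.2, one_mul]

/-- Convexity of D(·‖r), which vanishes at r. Moving towards r is the perturbation that breaks ties.
-/
theorem relEnt_mix_le {q r : Y → ℝ} (hq : q ∈ stdSimplex ℝ Y) (hr : r ∈ stdSimplex ℝ Y)
    (h : ∀ a, r a = 0 → q a = 0) {t : ℝ} (ht0 : 0 ≤ t) (ht1 : t ≤ 1) :
    relEnt ((1 - t) • q + t • r) r ≤ (1 - t) * relEnt q r := by
  have h' : ∀ a, r a = 0 → ((1 - t) • q + t • r) a = 0 := fun a ha => by simp [ha, h a ha]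
  have hc : negEnt ((1 - t) • q + t • r) ≤ (1 - t) * negEnt q + t * negEnt r := by
    rw [negEnt, negEnt, negEnt, Finset.mul_sum, Finset.mul_sum, ← Finset.sum_add_distrib]
    refine Finset.sum_le_sum fun a _ => ?_
    exact Real.convexOn_mul_log.2 (hq.1 a) (hr.1 a) (sub_nonneg.2 ht1) ht0 (by ring)
  rw [relEnt_eq h', relEnt_eq h]
  have e : ∑ a, ((1 - t) • q + t • r) a * Real.log (r a)
      = (1 - t) * ∑ a, q a * Real.log (r a) + t * negEnt r := by
    rw [negEnt, Finset.mul_sum, Finset.mul_sum, ← Finset.sum_add_distrib]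
    refine Finset.sum_congr rfl fun a _ => ?_
    simp only [Pi.add_apply, Pi.smul_apply, smul_eq_mul]
    ring
  rw [e]
  linarith

theorem mix_mem {q r : Y → ℝ} (hq : q ∈ stdSimplex ℝ Y) (hr : r ∈ stdSimplex ℝ Y)
    {t : ℝ} (ht0 : 0 ≤ t) (ht1 : t ≤ 1) : (1 - t) • q + t • r ∈ stdSimplex ℝ Y :=
  convex_stdSimplex ℝ Y hq hr (sub_nonneg.2 ht1) ht0 (by ring)

section avg

variable {ι : Type*} {A : Finset ι} {γ : ι → Y → ℝ}

theorem avgOn_mem (hA : A.Nonempty) (hγ : ∀ i, γ i ∈ stdSimplex ℝ Y) :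
    avgOn A γ ∈ stdSimplex ℝ Y := by
  refine ⟨fun a => div_nonneg (Finset.sum_nonneg fun i _ => (hγ i).1 a) (by positivity), ?_⟩
  simp only [avgOn]
  rw [← Finset.sum_div, Finset.sum_comm, Finset.sum_congr rfl fun i _ => (hγ i).2]
  simp [hA.card_pos.ne']

theorem avgOn_ac (hγ : ∀ i, γ i ∈ stdSimplex ℝ Y) {B : Finset ι} {i : ι} (hi : i ∈ B) :
    ∀ a, avgOn B γ a = 0 → γ i a = 0 := by
  intro a h
  have hB : (B.card : ℝ) ≠ 0 := by exact_mod_cast (Finset.card_pos.2 ⟨i, hi⟩).ne'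
  rw [avgOn, div_eq_zero_iff, or_iff_left hB,
    Finset.sum_eq_zero_iff_of_nonneg fun k _ => (hγ k).1 a] at h
  exact h i hi

theorem sum_relEnt_eq {r : Y → ℝ} (hA : A.Nonempty)
    (h : ∀ i ∈ A, ∀ a, r a = 0 → γ i a = 0) :
    ∑ j ∈ A, relEnt (γ j) r
      = ∑ j ∈ A, negEnt (γ j) - A.card * ∑ a, avgOn A γ a * Real.log (r a) := by
  rw [Finset.sum_congr rfl fun j hj => relEnt_eq (h j hj), Finset.sum_sub_distrib,
    Finset.sum_comm, Finset.mul_sum]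
  congr 1
  refine Finset.sum_congr rfl fun a _ => ?_
  rw [← mul_assoc, card_mul_avgOn hA, Finset.sum_mul]

theorem sum_relEnt_avgOn (hA : A.Nonempty) (hγ : ∀ i, γ i ∈ stdSimplex ℝ Y) :
    ∑ j ∈ A, relEnt (γ j) (avgOn A γ)
      = ∑ j ∈ A, negEnt (γ j) - A.card * negEnt (avgOn A γ) :=
  sum_relEnt_eq hA fun _ hi => avgOn_ac hγ hi

/-- The compensation identity. -/
theorem sum_relEnt_eq_add {r : Y → ℝ} (hA : A.Nonempty) (hγ : ∀ i, γ i ∈ stdSimplex ℝ Y)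
    (h : ∀ i ∈ A, ∀ a, r a = 0 → γ i a = 0) :
    ∑ j ∈ A, relEnt (γ j) r
      = ∑ j ∈ A, relEnt (γ j) (avgOn A γ) + A.card * relEnt (avgOn A γ) r := by
  rw [sum_relEnt_eq hA h, sum_relEnt_avgOn hA hγ, relEnt_eq (avgOn_ac_of_ac h)]
  ring

end avg

/-- The normalizing constant of `√(μ p)`. -/
theorem sum_sqrt_pos {μ p : Y → ℝ} (hμ : FullPmf μ) (hp : p ∈ stdSimplex ℝ Y) :
    0 < ∑ y, √(μ y) * √(p y) := by
  obtain ⟨a, _, ha⟩ : ∃ a ∈ Finset.univ, p a ≠ 0 :=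
    Finset.exists_ne_zero_of_sum_ne_zero (by rw [hp.2]; exact one_ne_zero)
  refine Finset.sum_pos' (fun b _ => by positivity) ⟨a, Finset.mem_univ a, ?_⟩
  exact mul_pos (Real.sqrt_pos.2 (hμ.pos a)) (Real.sqrt_pos.2 ((hp.1 a).lt_of_ne' ha))

/-- The gap is 2 D(q‖g), with g the normalized geometric mean of μ and p. Its nonnegativity is log x
≤ x - 1 at x = √(μp)/(qZ), summed against q. -/
theorem two_bhatt_le {μ p q : Y → ℝ} (hμ : FullPmf μ) (hp : p ∈ stdSimplex ℝ Y)
    (hq : q ∈ stdSimplex ℝ Y) (h : ∀ a, p a = 0 → q a = 0) :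
    2 * bhatt μ p ≤ relEnt q μ + relEnt q p := by
  have hZ := sum_sqrt_pos hμ hp
  rw [bhatt]
  set Z := ∑ y, √(μ y) * √(p y) with hZdef
  have key : ∀ a, 2 * (q a - √(μ a) * √(p a) / Z - q a * Real.log Z)
      ≤ q a * Real.log (q a / μ a) + q a * Real.log (q a / p a) := by
    intro a
    rcases (hq.1 a).eq_or_lt with h0 | h0
    · have : 0 ≤ √(μ a) * √(p a) / Z := by positivity
      simp only [← h0]
      linarith
    · have hpa : 0 < p a := (hp.1 a).lt_of_ne fun e => h0.ne' (h a e.symm)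
      have hma := hμ.pos a
      have h1 := Real.sqrt_pos.2 hma
      have h2 := Real.sqrt_pos.2 hpa
      have hl := Real.log_le_sub_one_of_pos (div_pos (mul_pos h1 h2) (mul_pos h0 hZ))
      rw [Real.log_div (mul_pos h1 h2).ne' (mul_pos h0 hZ).ne', Real.log_mul h1.ne' h2.ne',
        Real.log_mul h0.ne' hZ.ne', Real.log_sqrt hma.le, Real.log_sqrt hpa.le] at hl
      have := mul_le_mul_of_nonneg_left hl h0.le
      have e : q a * (√(μ a) * √(p a) / (q a * Z) - 1) = √(μ a) * √(p a) / Z - q a := by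
        field_simp
      rw [e] at this
      rw [Real.log_div h0.ne' hma.ne', Real.log_div h0.ne' hpa.ne']
      linarith
  have := Finset.sum_le_sum fun a (_ : a ∈ Finset.univ) => key a
  rw [← Finset.mul_sum, Finset.sum_sub_distrib, Finset.sum_sub_distrib, ← Finset.sum_div,
    ← Finset.sum_mul, hq.2, ← hZdef, div_self hZ.ne', Finset.sum_add_distrib] at this
  rw [relEnt, relEnt]
  linarith

/-- The normalized geometric mean of two pmfs. -/
noncomputable def geoMean (μ p : Y → ℝ) (a : Y) : ℝ :=
  √(μ a) * √(p a) / ∑ y, √(μ y) * √(p y)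

theorem geoMean_full {μ p : Y → ℝ} (hμ : FullPmf μ) (hp : FullPmf p) :
    FullPmf (geoMean μ p) := by
  have hZ := sum_sqrt_pos hμ hp.mem
  have hpos : ∀ a, 0 < geoMean μ p a := fun a =>
    div_pos (mul_pos (Real.sqrt_pos.2 (hμ.pos a)) (Real.sqrt_pos.2 (hp.pos a))) hZ
  refine ⟨⟨fun a => (hpos a).le, ?_⟩, hpos⟩
  simp only [geoMean]
  rw [← Finset.sum_div, div_self hZ.ne']

/-- The equality case of `two_bhatt_le`. -/
theorem relEnt_geoMean {μ p : Y → ℝ} (hμ : FullPmf μ) (hp : FullPmf p) :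
    relEnt (geoMean μ p) μ + relEnt (geoMean μ p) p = 2 * bhatt μ p := by
  have hg := geoMean_full hμ hp
  have hZ := sum_sqrt_pos hμ hp.mem
  have key : ∀ a, geoMean μ p a * Real.log (geoMean μ p a / μ a)
      + geoMean μ p a * Real.log (geoMean μ p a / p a)
      = geoMean μ p a * (2 * bhatt μ p) := by
    intro a
    have hma := hμ.pos a
    have hpa := hp.pos a
    have h1 := Real.sqrt_pos.2 hma
    have h2 := Real.sqrt_pos.2 hpa
    have : Real.log (geoMean μ p a) = Real.log (μ a) / 2 + Real.log (p a) / 2 + bhatt μ p := by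
      rw [geoMean, Real.log_div (mul_pos h1 h2).ne' hZ.ne', Real.log_mul h1.ne' h2.ne',
        Real.log_sqrt hma.le, Real.log_sqrt hpa.le, bhatt]
      ring
    rw [Real.log_div (hg.pos a).ne' hma.ne', Real.log_div (hg.pos a).ne' hpa.ne', this]
    ring
  rw [relEnt, relEnt, ← Finset.sum_add_distrib, Finset.sum_congr rfl fun a _ => key a,
    ← Finset.sum_mul, hg.mem.2, one_mul]

/-- A lower bound on the Bhattacharyya distance to `q` in terms of the distance to `π`. -/
theorem bhatt_sub_le {μ π q : Y → ℝ} (hμ : FullPmf μ) (hπ : FullPmf π)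
    (hq : q ∈ stdSimplex ℝ Y) :
    bhatt μ π - √(relEnt q π) * Real.exp (cConst π / 2) ≤ bhatt μ q := by
  have hZ := sum_sqrt_pos hμ hπ.mem
  have hZq := sum_sqrt_pos hμ hq
  set Z := ∑ y, √(μ y) * √(π y) with hZdef
  set Zq := ∑ y, √(μ y) * √(q y) with hZqdef
  -- Cauchy–Schwarz against √μ, a unit vector, then the Hellinger bound.
  have h1 : Zq - Z ≤ √(relEnt q π) := by
    refine Real.le_sqrt_of_sq_le (le_trans ?_ (hellinger_le_relEnt hq hπ.mem (hπ.ac q)))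
    have := Finset.sum_mul_sq_le_sq_mul_sq Finset.univ (fun y => √(μ y))
      (fun y => √(q y) - √(π y))
    simp only [Real.sq_sqrt (hμ.mem.1 _), hμ.mem.2, one_mul, mul_sub,
      Finset.sum_sub_distrib] at this
    exact this
  -- This bound does not depend on μ, which makes the estimate uniform over the outlier laws.
  have h2 : Real.exp (-(cConst π / 2)) ≤ Z := by
    have hle : ∀ y, μ y * Real.exp (-(cConst π / 2)) ≤ √(μ y) * √(π y) := by
      intro y
      have a1 : μ y ≤ √(μ y) := by
        refine Real.le_sqrt_of_sq_le ?_
        have := pmf_le_one hμ.mem y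
        nlinarith [hμ.pos y]
      have a2 : Real.exp (-(cConst π / 2)) ≤ √(π y) := by
        rw [← Real.exp_log (Real.sqrt_pos.2 (hπ.pos y)), Real.log_sqrt (hπ.pos y).le]
        refine Real.exp_le_exp.2 ?_
        linarith [le_cConst hπ y]
      gcongr
    calc Real.exp (-(cConst π / 2)) = ∑ y, μ y * Real.exp (-(cConst π / 2)) := by
          rw [← Finset.sum_mul, hμ.mem.2, one_mul]
      _ ≤ Z := Finset.sum_le_sum fun y _ => hle y
  have h3 : Real.log Zq ≤ Real.log Z + (Zq - Z) / Z := by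
    have := Real.log_le_sub_one_of_pos (div_pos hZq hZ)
    rw [Real.log_div hZq.ne' hZ.ne'] at this
    have e : (Zq - Z) / Z = Zq / Z - 1 := by field_simp
    linarith
  have h4 : (Zq - Z) / Z ≤ √(relEnt q π) * Real.exp (cConst π / 2) := by
    calc (Zq - Z) / Z ≤ √(relEnt q π) / Z := by gcongr
      _ ≤ √(relEnt q π) / Real.exp (-(cConst π / 2)) := by gcongr
      _ = _ := by rw [Real.exp_neg, div_inv_eq_mul]
  simp only [bhatt]
  linarith

theorem bhatt_pos {μ π : Y → ℝ} (hμ : FullPmf μ) (hπ : FullPmf π) (hne : μ ≠ π) :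
    0 < bhatt μ π := by
  have hg := geoMean_full hμ hπ
  have h1 := relEnt_nonneg hg.mem hμ.mem (hμ.ac _)
  have h2 := relEnt_nonneg hg.mem hπ.mem (hπ.ac _)
  have h3 := relEnt_geoMean hμ hπ
  by_cases h : geoMean μ π = μ
  · have := relEnt_pos hg.mem hπ.mem (hπ.ac _) (h.trans_ne hne)
    linarith
  · have := relEnt_pos hg.mem hμ.mem (hμ.ac _) h
    linarith

end relEnt

/-! ### The method of types. -/

section types

variable {Y : Type*} {M n : ℕ}

/-- The law of each coordinate when `S` is the set of outliers. -/
noncomputable def law (μ : Fin M → Y → ℝ) (π : Y → ℝ) (S : Finset (Fin M)) (i : Fin M) : Y → ℝ :=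
  if i ∈ S then μ i else π

/-- The pmf of independent samples with laws `p i`. -/
noncomputable def prodProb (p : Fin M → Y → ℝ) (y : Data Y M n) : ℝ := ∏ i, ∏ k, p i (y i k)

theorem jointProb_eq_prodProb (μ : Fin M → Y → ℝ) (π : Y → ℝ) (S : Finset (Fin M))
    (y : Data Y M n) : jointProb μ π S y = prodProb (law μ π S) y := by
  rw [jointProb, prodProb, Finset.prod_comm]
  refine Finset.prod_congr rfl fun k _ => ?_
  rw [← Finset.prod_mul_prod_compl S fun i => law μ π S i (y i k)]
  congr 1
  · exact Finset.prod_congr rfl fun i hi => by rw [law, if_pos hi]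
  · exact Finset.prod_congr rfl fun i hi => by rw [law, if_neg (Finset.mem_compl.1 hi)]

/-- The empirical distributions of all the coordinates. -/
noncomputable def emp [DecidableEq Y] (y : Data Y M n) (i : Fin M) : Y → ℝ := empirical (y i)

variable [Fintype Y]

/-- The rate of the empirical distributions `γ` under independent samples of laws `p i`. -/
noncomputable def cost (p γ : Fin M → Y → ℝ) : ℝ := ∑ i, relEnt (γ i) (p i)

theorem law_full {μ : Fin M → Y → ℝ} {π : Y → ℝ} (hμ : ∀ i, FullPmf (μ i)) (hπ : FullPmf π)
    (S : Finset (Fin M)) (i : Fin M) : FullPmf (law μ π S i) := by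
  rw [law]
  split_ifs
  exacts [hμ i, hπ]

theorem continuous_cost {p : Fin M → Y → ℝ} (hp : ∀ i, FullPmf (p i)) : Continuous (cost p) :=
  continuous_finsetSum _ fun i _ => (continuous_relEnt (hp i)).comp (continuous_apply i)

theorem relEnt_le_cost {p γ : Fin M → Y → ℝ} (hp : ∀ i, FullPmf (p i))
    (hγ : ∀ i, γ i ∈ stdSimplex ℝ Y) (i : Fin M) : relEnt (γ i) (p i) ≤ cost p γ :=
  Finset.single_le_sum (f := fun i => relEnt (γ i) (p i))
    (fun j _ => relEnt_nonneg (hγ j) (hp j).mem ((hp j).ac _)) (Finset.mem_univ i)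

variable [DecidableEq Y]

omit [DecidableEq Y] in
theorem sum_prodProb {p : Fin M → Y → ℝ} (hp : ∀ i, p i ∈ stdSimplex ℝ Y) :
    ∑ y : Data Y M n, prodProb p y = 1 := by
  simp only [prodProb]
  have h1 : ∀ i, ∑ x : Fin n → Y, ∏ k, p i (x k) = 1 := by
    intro i
    have := Finset.prod_univ_sum (fun _ : Fin n => (Finset.univ : Finset Y)) fun _ a => p i a
    rw [Fintype.piFinset_univ] at this
    rw [← this]
    simp [(hp i).2]
  have := Finset.prod_univ_sum (fun _ : Fin M => (Finset.univ : Finset (Fin n → Y)))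
    fun i x => ∏ k, p i (x k)
  rw [Fintype.piFinset_univ] at this
  rw [← this]
  simp [h1]

omit [DecidableEq Y] in
theorem prodProb_nonneg {p : Fin M → Y → ℝ} (hp : ∀ i, p i ∈ stdSimplex ℝ Y)
    (y : Data Y M n) : 0 ≤ prodProb p y :=
  Finset.prod_nonneg fun i _ => Finset.prod_nonneg fun _ _ => (hp i).1 _

theorem sum_empirical_mul (hn : 0 < n) (x : Fin n → Y) (f : Y → ℝ) :
    n * ∑ a, empirical x a * f a = ∑ k, f (x k) := by
  have hn' : (n : ℝ) ≠ 0 := by exact_mod_cast hn.ne'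
  rw [Finset.mul_sum, ← Finset.sum_fiberwise Finset.univ x fun k => f (x k)]
  refine Finset.sum_congr rfl fun a _ => ?_
  rw [Finset.sum_congr rfl fun k hk => by rw [(Finset.mem_filter.1 hk).2], Finset.sum_const,
    nsmul_eq_mul, empirical]
  field_simp

theorem empirical_mem (hn : 0 < n) (x : Fin n → Y) : empirical x ∈ stdSimplex ℝ Y := by
  refine ⟨fun a => by unfold empirical; positivity, ?_⟩
  have h := sum_empirical_mul hn x fun _ => 1
  have hn' : (n : ℝ) ≠ 0 := by exact_mod_cast hn.ne'
  simpa [hn'] using h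

omit [Fintype Y] in
theorem empirical_apply_pos (x : Fin n → Y) (k : Fin n) : 0 < empirical x (x k) := by
  have hn : 0 < n := k.pos
  have : 0 < (Finset.univ.filter fun l => x l = x k).card :=
    Finset.card_pos.2 ⟨k, by simp⟩
  unfold empirical
  positivity

/-- Change of measure in terms of the empirical distribution. -/
theorem prodProb_eq_exp_mul (hn : 0 < n) {p r : Fin M → Y → ℝ} (y : Data Y M n)
    (hp : ∀ i k, 0 < p i (y i k)) (hr : ∀ i k, 0 < r i (y i k)) :
    prodProb p y = Real.exp (n * ∑ i, ∑ a, emp y i a * (Real.log (p i a) - Real.log (r i a)))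
      * prodProb r y := by
  rw [Finset.mul_sum, Real.exp_sum, prodProb, prodProb, ← Finset.prod_mul_distrib]
  refine Finset.prod_congr rfl fun i _ => ?_
  rw [emp, sum_empirical_mul hn (y i) fun a => Real.log (p i a) - Real.log (r i a), Real.exp_sum,
    ← Finset.prod_mul_distrib]
  refine Finset.prod_congr rfl fun k _ => ?_
  rw [Real.exp_sub, Real.exp_log (hp i k), Real.exp_log (hr i k), div_mul_cancel₀ _ (hr i k).ne']

/-- Change of measure to the empirical law of `y` itself: the entire dependence on `p` sits in the
exponential factor. -/
theorem prodProb_eq_exp_cost (hn : 0 < n) {p : Fin M → Y → ℝ} (hp : ∀ i, FullPmf (p i))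
    (y : Data Y M n) :
    prodProb p y = Real.exp (-(n * cost p (emp y))) * prodProb (emp y) y := by
  rw [prodProb_eq_exp_mul hn y (fun i k => (hp i).pos _)
    (fun i k => empirical_apply_pos (y i) k), cost, ← mul_neg, ← Finset.sum_neg_distrib]
  congr 4
  ext i
  rw [relEnt_eq ((hp i).ac _), negEnt, ← Finset.sum_sub_distrib, ← Finset.sum_neg_distrib]
  exact Finset.sum_congr rfl fun a _ => by simp only [emp]; ring

/-- Each term is at most the sum over all occurring types τ of the probability of `y` under τ. Every
τ has total mass 1, and types are determined by M·|Y| counts in {0, …, n}. -/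
theorem sum_prodProb_emp_le (hn : 0 < n) :
    ∑ y : Data Y M n, prodProb (emp y) y ≤ ((n : ℝ) + 1) ^ (Fintype.card Y * M) := by
  classical
  set I : Finset (Fin M → Y → ℝ) := Finset.univ.image fun y : Data Y M n => emp y with hI
  have hmem : ∀ τ ∈ I, ∀ i, τ i ∈ stdSimplex ℝ Y := by
    intro τ hτ i
    obtain ⟨y, _, rfl⟩ := Finset.mem_image.1 hτ
    exact empirical_mem hn (y i)
  have hcard : I.card ≤ (n + 1) ^ (Fintype.card Y * M) := by
    have hsub : I ⊆ (Finset.univ : Finset (Fin M → Y → Fin (n + 1))).image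
        fun c i a => ((c i a : ℕ) : ℝ) / n := by
      intro τ hτ
      obtain ⟨y, _, rfl⟩ := Finset.mem_image.1 hτ
      refine Finset.mem_image.2 ⟨fun i a => ⟨(Finset.univ.filter fun k => y i k = a).card, ?_⟩,
        Finset.mem_univ _, rfl⟩
      exact Nat.lt_succ_of_le ((Finset.card_le_univ _).trans (Fintype.card_fin n).le)
    refine (Finset.card_le_card hsub).trans (Finset.card_image_le.trans ?_)
    simp [pow_mul]
  calc ∑ y : Data Y M n, prodProb (emp y) y ≤ ∑ y : Data Y M n, ∑ τ ∈ I, prodProb τ y :=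
        Finset.sum_le_sum fun y _ => Finset.single_le_sum (f := fun τ => prodProb τ y)
          (fun τ hτ => prodProb_nonneg (hmem τ hτ) y)
          (Finset.mem_image_of_mem _ (Finset.mem_univ y))
    _ = ∑ τ ∈ I, 1 := by
        rw [Finset.sum_comm]
        exact Finset.sum_congr rfl fun τ hτ => sum_prodProb (hmem τ hτ)
    _ = (I.card : ℝ) := by simp
    _ ≤ ((n : ℝ) + 1) ^ (Fintype.card Y * M) := by exact_mod_cast hcard

/-- The upper bound of Sanov's theorem. -/
theorem sum_prodProb_le (hn : 0 < n) {p : Fin M → Y → ℝ} (hp : ∀ i, FullPmf (p i))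
    (A : Finset (Data Y M n)) {E : ℝ} (hA : ∀ y ∈ A, E ≤ cost p (emp y)) :
    ∑ y ∈ A, prodProb p y ≤ ((n : ℝ) + 1) ^ (Fintype.card Y * M) * Real.exp (-(n * E)) := by
  have hnn : ∀ y : Data Y M n, 0 ≤ prodProb (emp y) y :=
    prodProb_emp_nonneg
  calc ∑ y ∈ A, prodProb p y ≤ ∑ y ∈ A, Real.exp (-(n * E)) * prodProb (emp y) y := by
        refine Finset.sum_le_sum fun y hy => ?_
        rw [prodProb_eq_exp_cost hn hp]
        have := hA y hy
        have := hnn y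
        gcongr
    _ ≤ ∑ y, Real.exp (-(n * E)) * prodProb (emp y) y :=
        Finset.sum_le_univ_sum_of_nonneg fun y => mul_nonneg (Real.exp_nonneg _) (hnn y)
    _ ≤ _ := by
        rw [← Finset.mul_sum, mul_comm]
        exact mul_le_mul_of_nonneg_right (sum_prodProb_emp_le hn) (Real.exp_nonneg _)
  where
  prodProb_emp_nonneg (y : Data Y M n) : 0 ≤ prodProb (emp y) y :=
    prodProb_nonneg (fun i => empirical_mem hn (y i)) y

end types

theorem tendsto_succ_pow_mul_exp (K : ℕ) {c : ℝ} (hc : 0 < c) :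
    Tendsto (fun n : ℕ => ((n : ℝ) + 1) ^ K * Real.exp (-(n * c))) atTop (𝓝 0) := by
  have h := tendsto_pow_const_mul_const_pow_of_abs_lt_one K (r := Real.exp (-c))
    (by rw [Real.abs_exp]; exact Real.exp_lt_one_iff.2 (neg_lt_zero.2 hc))
  -- The shift from n to n + 1 costs a factor exp(-c), which `exp c` restores.
  have h2 := ((tendsto_add_atTop_iff_nat 1).2 h).mul_const (Real.exp c)
  rw [zero_mul] at h2
  refine h2.congr fun n => ?_
  push_cast
  rw [mul_assoc, ← Real.exp_nat_mul, ← Real.exp_add]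
  congr 2
  push_cast
  ring

/-! ### Change of measure and the criterion for error exponents. -/

section lower

variable {Y : Type*} [Fintype Y] [DecidableEq Y] {M : ℕ}

/-- Concentration of the empirical distributions. -/
theorem tendsto_sum_prodProb_notMem {γ : Fin M → Y → ℝ} (hγ : ∀ i, FullPmf (γ i))
    {U : Set (Fin M → Y → ℝ)} [DecidablePred (· ∈ U)] (hU : U ∈ 𝓝 γ) :
    Tendsto (fun n : ℕ => ∑ y ∈ (Finset.univ : Finset (Data Y M n)).filter (fun y => emp y ∉ U),
      prodProb γ y) atTop (𝓝 0) := by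
  obtain ⟨η, hη, hball⟩ := Metric.mem_nhds_iff.1 hU
  -- Outside `U` some entry is off by at least η. Since |q - p| ≤ 2|√q - √p| on [0, 1], the
  -- Hellinger bound makes the cost at least (η/2)².
  have hc : 0 < (η / 2) ^ 2 := by positivity
  refine squeeze_zero' (Eventually.of_forall fun n => Finset.sum_nonneg fun y _ =>
    prodProb_nonneg (fun i => (hγ i).mem) y) ?_
    (tendsto_succ_pow_mul_exp (Fintype.card Y * M) hc)
  filter_upwards [eventually_gt_atTop 0] with n hn
  refine sum_prodProb_le hn hγ _ fun y hy => ?_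
  have hy' : ¬ dist (emp y) γ < η := fun h => (Finset.mem_filter.1 hy).2 (hball h)
  simp only [dist_pi_lt_iff hη, not_forall, not_lt] at hy'
  obtain ⟨i, a, hia⟩ := hy'
  have hmem : ∀ i, emp y i ∈ stdSimplex ℝ Y := fun i => empirical_mem hn (y i)
  refine le_trans ?_ (relEnt_le_cost hγ hmem i)
  refine le_trans ?_ (hellinger_le_relEnt (hmem i) (hγ i).mem ((hγ i).ac _))
  refine le_trans ?_ (Finset.single_le_sum (f := fun a => (√(emp y i a) - √(γ i a)) ^ 2)
    (fun _ _ => sq_nonneg _) (Finset.mem_univ a))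
  have q1 := Real.sqrt_le_one.2 (pmf_le_one (hmem i) a)
  have q2 := Real.sqrt_le_one.2 (pmf_le_one (hγ i).mem a)
  have q3 := Real.sqrt_nonneg (emp y i a)
  have q4 := Real.sqrt_nonneg (γ i a)
  have hfac : |emp y i a - γ i a|
      = |√(emp y i a) - √(γ i a)| * (√(emp y i a) + √(γ i a)) := by
    conv_lhs => rw [← Real.mul_self_sqrt ((hmem i).1 a), ← Real.mul_self_sqrt ((hγ i).mem.1 a)]
    rw [mul_self_sub_mul_self, abs_mul, abs_of_nonneg (add_nonneg q3 q4), mul_comm]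
  rw [Real.dist_eq, hfac] at hia
  rw [← sq_abs (√(emp y i a) - √(γ i a))]
  refine pow_le_pow_left₀ (by positivity) ?_ 2
  nlinarith [abs_nonneg (√(emp y i a) - √(γ i a))]

/-- The normalized log-likelihood ratio is a linear function φ of the empirical laws, hence
continuous, and φ(γ) is minus the cost of γ. -/
theorem exists_nhds_exp_mul_le_prodProb {p γ : Fin M → Y → ℝ} (hp : ∀ i, FullPmf (p i))
    (hγ : ∀ i, FullPmf (γ i)) {c : ℝ} (hc : cost p γ < c) :
    ∃ U ∈ 𝓝 γ, ∀ (n : ℕ), 0 < n → ∀ y : Data Y M n, emp y ∈ U →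
      Real.exp (-(n * c)) * prodProb γ y ≤ prodProb p y := by
  set φ : (Fin M → Y → ℝ) → ℝ :=
    fun q => ∑ i, ∑ a, q i a * (Real.log (p i a) - Real.log (γ i a)) with hφ
  have hφc : Continuous φ := by fun_prop
  have hφγ : φ γ = -cost p γ := by
    rw [hφ, cost, ← Finset.sum_neg_distrib]
    refine Finset.sum_congr rfl fun i _ => ?_
    rw [relEnt_eq ((hp i).ac _), negEnt, ← Finset.sum_sub_distrib, ← Finset.sum_neg_distrib]
    exact Finset.sum_congr rfl fun a _ => by ring
  refine ⟨{q | -c < φ q}, (isOpen_lt continuous_const hφc).mem_nhds ?_, ?_⟩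
  · rw [Set.mem_ofPred_eq, hφγ]
    linarith
  · intro n hn y hy
    rw [prodProb_eq_exp_mul hn (r := γ) y (fun i k => (hp i).pos _) (fun i k => (hγ i).pos _)]
    refine mul_le_mul_of_nonneg_right (Real.exp_le_exp.2 ?_)
      (prodProb_nonneg (fun i => (hγ i).mem) y)
    rw [← mul_neg]
    exact mul_le_mul_of_nonneg_left (le_of_lt hy) (Nat.cast_nonneg n)

omit [DecidableEq Y] in
theorem le_maxError {T n : ℕ} (d : Rule Y M) (μ : Fin M → Y → ℝ) (π : Y → ℝ)
    {S : Finset (Fin M)} (hS : S.card = T) :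
    ∑ y ∈ (Finset.univ : Finset (Data Y M n)).filter (fun y => d n y ≠ S),
      prodProb (law μ π S) y ≤ maxError T d μ π n := by
  simp_rw [← jointProb_eq_prodProb]
  exact le_ciSup (f := fun S : {S : Finset (Fin M) // S.card = T} =>
    ∑ y ∈ (Finset.univ : Finset (Data Y M n)).filter (fun y => d n y ≠ S.1), jointProb μ π S.1 y)
    (Set.finite_range _).bddAbove ⟨S, hS⟩

/-- The error exponent is at most `c` if near some `γ`, of cost at most `c` under both `S` and
`S'`, the test misses at least one of `S` and `S'`. -/
theorem exp_le_maxError {T : ℕ} (d : Rule Y M) {μ : Fin M → Y → ℝ} {π : Y → ℝ}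
    (hμ : ∀ i, FullPmf (μ i)) (hπ : FullPmf π) {S S' : Finset (Fin M)} (hS : S.card = T)
    (hS' : S'.card = T) {γ : Fin M → Y → ℝ} (hγ : ∀ i, FullPmf (γ i))
    {U : Set (Fin M → Y → ℝ)} (hU : U ∈ 𝓝 γ)
    (hd : ∀ n, 0 < n → ∀ y : Data Y M n, emp y ∈ U → d n y ≠ S ∨ d n y ≠ S') {c : ℝ}
    (h : cost (law μ π S) γ < c) (h' : cost (law μ π S') γ < c) :
    ∀ᶠ n : ℕ in atTop, Real.exp (-(n * c)) ≤ maxError T d μ π n := by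
  classical
  -- The gap between c₁ and c absorbs the constant factor 1/4 below.
  obtain ⟨c₁, hc₁, hc₁c⟩ := exists_between (max_lt h h')
  obtain ⟨U₁, hU₁, hb₁⟩ := exists_nhds_exp_mul_le_prodProb (law_full hμ hπ S) hγ
    ((le_max_left _ _).trans_lt hc₁)
  obtain ⟨U₂, hU₂, hb₂⟩ := exists_nhds_exp_mul_le_prodProb (law_full hμ hπ S') hγ
    ((le_max_right _ _).trans_lt hc₁)
  have hV : U ∩ (U₁ ∩ U₂) ∈ 𝓝 γ := inter_mem hU (inter_mem hU₁ hU₂)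
  have hsmall := tendsto_succ_pow_mul_exp 0 (sub_pos.2 hc₁c)
  filter_upwards [eventually_gt_atTop 0,
    (tendsto_sum_prodProb_notMem hγ hV).eventually (ge_mem_nhds (show (0 : ℝ) < 1 / 2 by norm_num)),
    hsmall.eventually (ge_mem_nhds (show (0 : ℝ) < 1 / 4 by norm_num))] with n hn hconc hexp
  set V := U ∩ (U₁ ∩ U₂) with hVdef
  have hγn : ∀ y : Data Y M n, 0 ≤ prodProb γ y := prodProb_nonneg fun i => (hγ i).mem
  have htot := Finset.sum_filter_add_sum_filter_not (Finset.univ : Finset (Data Y M n))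
    (fun y => emp y ∈ V) (prodProb γ)
  rw [sum_prodProb fun i => (hγ i).mem] at htot
  have hbound : ∀ (R : Finset (Fin M)), R.card = T →
      (∀ y : Data Y M n, emp y ∈ V → Real.exp (-(n * c₁)) * prodProb γ y
        ≤ prodProb (law μ π R) y) →
      Real.exp (-(n * c₁)) * ∑ y ∈ (Finset.univ : Finset (Data Y M n)).filter
        (fun y => emp y ∈ V ∧ d n y ≠ R), prodProb γ y ≤ maxError T d μ π n := by
    intro R hR hb
    refine le_trans ?_ (le_maxError d μ π hR)
    rw [Finset.mul_sum]
    refine (Finset.sum_le_sum fun y hy => hb y (Finset.mem_filter.1 hy).2.1).trans ?_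
    refine Finset.sum_le_sum_of_subset_of_nonneg ?_
      fun y _ _ => prodProb_nonneg (fun i => (law_full hμ hπ R i).mem) y
    intro y hy
    simp only [Finset.mem_filter] at hy ⊢
    exact ⟨hy.1, hy.2.2⟩
  have e1 := hbound S hS fun y hy => hb₁ n hn y hy.2.1
  have e2 := hbound S' hS' fun y hy => hb₂ n hn y hy.2.2
  -- All data typed in `V`, of γ-mass at least 1/2, are misjudged under `S` or under `S'`, so one of
  -- the two error events has γ-mass at least 1/4.
  have hcover : ∑ y ∈ (Finset.univ : Finset (Data Y M n)).filter (fun y => emp y ∈ V),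
      prodProb γ y ≤
      ∑ y ∈ (Finset.univ : Finset (Data Y M n)).filter (fun y => emp y ∈ V ∧ d n y ≠ S),
        prodProb γ y +
      ∑ y ∈ (Finset.univ : Finset (Data Y M n)).filter (fun y => emp y ∈ V ∧ d n y ≠ S'),
        prodProb γ y := by
    refine (Finset.sum_le_sum_of_subset_of_nonneg (fun y hy => ?_) fun y _ _ => hγn y).trans
      ((le_add_of_nonneg_right (Finset.sum_nonneg fun y _ => hγn y)).trans
        (Finset.sum_union_inter).le)
    simp only [Finset.mem_filter, Finset.mem_union, Finset.mem_univ, true_and] at hy ⊢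
    exact (hd n hn y hy.1).imp (fun h => ⟨hy, h⟩) fun h => ⟨hy, h⟩
  have hpos := Real.exp_pos (-(n * c₁))
  have hfin : Real.exp (-(n * c₁)) * (1 / 4) ≤ maxError T d μ π n := by
    have := mul_le_mul_of_nonneg_left hcover hpos.le
    rw [mul_add] at this
    have h12 : 1 / 2 ≤ ∑ y ∈ (Finset.univ : Finset (Data Y M n)).filter (fun y => emp y ∈ V),
      prodProb γ y := by linarith
    have := mul_le_mul_of_nonneg_left h12 hpos.le
    linarith
  refine le_trans ?_ hfin
  rw [pow_zero, one_mul] at hexp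
  calc Real.exp (-(n * c)) = Real.exp (-(n * c₁)) * Real.exp (-(n * (c - c₁))) := by
        rw [← Real.exp_add]; congr 1; ring
    _ ≤ _ := mul_le_mul_of_nonneg_left hexp hpos.le

/-- A criterion for the error exponent of a test. -/
theorem hasErrorExponent_of_cost {T : ℕ} {d : Rule Y M} {μ : Fin M → Y → ℝ} {π : Y → ℝ}
    (hμ : ∀ i, FullPmf (μ i)) (hπ : FullPmf π) {E : ℝ}
    (hT : ∃ S : Finset (Fin M), S.card = T)
    (hupper : ∀ S : Finset (Fin M), S.card = T → ∀ n, 0 < n → ∀ y : Data Y M n, d n y ≠ S →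
      E ≤ cost (law μ π S) (emp y))
    (hlower : ∀ c, E < c → ∀ᶠ n : ℕ in atTop, Real.exp (-(n * c)) ≤ maxError T d μ π n) :
    HasErrorExponent T d μ π E := by
  have hle : ∀ n : ℕ, 0 < n → maxError T d μ π n
      ≤ ((n : ℝ) + 1) ^ (Fintype.card Y * M) * Real.exp (-(n * E)) := by
    intro n hn
    obtain ⟨S₀, hS₀⟩ := hT
    have : Nonempty {S : Finset (Fin M) // S.card = T} := ⟨⟨S₀, hS₀⟩⟩
    refine ciSup_le fun S => ?_
    simp_rw [jointProb_eq_prodProb]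
    exact sum_prodProb_le hn (law_full hμ hπ S.1) _
      fun y hy => hupper S.1 S.2 n hn y (Finset.mem_filter.1 hy).2
  rw [HasErrorExponent, tendsto_order]
  constructor
  · intro b hb
    obtain ⟨b', hb', hbE⟩ := exists_between hb
    -- The bound at `E + 1` only provides positivity of the error, needed because `Real.log 0 = 0`.
    filter_upwards [eventually_gt_atTop 0, hlower (E + 1) (by linarith),
      (tendsto_succ_pow_mul_exp (Fintype.card Y * M) (sub_pos.2 hbE)).eventually
        (ge_mem_nhds one_pos)] with n hn hpos h1
    have hn' : (0 : ℝ) < n := by exact_mod_cast hn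
    have h2 : maxError T d μ π n ≤ Real.exp (-(n * b')) := by
      refine (hle n hn).trans ?_
      calc ((n : ℝ) + 1) ^ (Fintype.card Y * M) * Real.exp (-(n * E))
          = ((n : ℝ) + 1) ^ (Fintype.card Y * M) * Real.exp (-(n * (E - b')))
            * Real.exp (-(n * b')) := by
            rw [mul_assoc, ← Real.exp_add]; congr 2; ring
        _ ≤ 1 * Real.exp (-(n * b')) := mul_le_mul_of_nonneg_right h1 (Real.exp_nonneg _)
        _ = _ := one_mul _
    have h3 := Real.log_le_log ((Real.exp_pos _).trans_le hpos) h2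
    rw [Real.log_exp] at h3
    refine hb'.trans_le ?_
    rw [neg_mul, one_div, ← div_eq_inv_mul, le_neg, div_le_iff₀ hn']
    linarith
  · intro b hb
    obtain ⟨b', hb', hbE⟩ := exists_between hb
    filter_upwards [eventually_gt_atTop 0, hlower b' hb'] with n hn h2
    have hn' : (0 : ℝ) < n := by exact_mod_cast hn
    have h3 := Real.log_le_log (Real.exp_pos _) h2
    rw [Real.log_exp] at h3
    refine lt_of_le_of_lt ?_ hbE
    rw [neg_mul, one_div, ← div_eq_inv_mul, neg_le, le_div_iff₀ hn']
    linarith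

end lower

/-! ### The universal statistic as a function of the empirical laws. -/

section functional

variable {Y : Type*} {ι : Type*}

theorem avgOn_congr {A : Finset ι} {γ γ' : ι → Y → ℝ} (h : ∀ i ∈ A, γ i = γ' i) :
    avgOn A γ = avgOn A γ' := by
  ext a
  rw [avgOn, avgOn, Finset.sum_congr rfl fun i hi => by rw [h i hi]]

variable [Fintype Y]

/-- The total divergence of a family of pmfs from its average, in terms of entropies. -/
noncomputable def jsd (A : Finset ι) (γ : ι → Y → ℝ) : ℝ :=
  ∑ j ∈ A, negEnt (γ j) - A.card * negEnt (avgOn A γ)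

/-- The reason for the entropy form: it is continuous everywhere, with no support condition on the
average, so weak preference is closed and strict preference is open. -/
theorem continuous_jsd (A : Finset ι) : Continuous (jsd A : (ι → Y → ℝ) → ℝ) := by
  refine (continuous_finsetSum _ fun i _ => continuous_negEnt.comp (continuous_apply i)).sub
    (continuous_const.mul (continuous_negEnt.comp ?_))
  unfold avgOn
  fun_prop

theorem jsd_congr {A : Finset ι} {γ γ' : ι → Y → ℝ} (h : ∀ i ∈ A, γ i = γ' i) :
    jsd A γ = jsd A γ' := by
  rw [jsd, jsd, avgOn_congr h, Finset.sum_congr rfl fun i hi => by rw [h i hi]]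

variable {A : Finset ι} {γ : ι → Y → ℝ}

theorem jsd_eq (hA : A.Nonempty) (hγ : ∀ i, γ i ∈ stdSimplex ℝ Y) :
    jsd A γ = ∑ j ∈ A, relEnt (γ j) (avgOn A γ) :=
  (sum_relEnt_avgOn hA hγ).symm

theorem sum_relEnt_eq_jsd_add {r : Y → ℝ} (hA : A.Nonempty) (hγ : ∀ i, γ i ∈ stdSimplex ℝ Y)
    (h : ∀ i ∈ A, ∀ a, r a = 0 → γ i a = 0) :
    ∑ j ∈ A, relEnt (γ j) r = jsd A γ + A.card * relEnt (avgOn A γ) r := by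
  rw [sum_relEnt_eq_add hA hγ h, jsd_eq hA hγ]

/-- By the compensation identity, the average is the best common reference. -/
theorem jsd_le_sum_relEnt {r : Y → ℝ} (hA : A.Nonempty) (hγ : ∀ i, γ i ∈ stdSimplex ℝ Y)
    (hr : r ∈ stdSimplex ℝ Y) (h : ∀ i ∈ A, ∀ a, r a = 0 → γ i a = 0) :
    jsd A γ ≤ ∑ j ∈ A, relEnt (γ j) r := by
  rw [sum_relEnt_eq_jsd_add hA hγ h]
  have := relEnt_nonneg (avgOn_mem hA hγ) hr (avgOn_ac_of_ac h)
  exact le_add_of_nonneg_right (by positivity)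

theorem relEnt_avgOn_nonneg (hγ : ∀ i, γ i ∈ stdSimplex ℝ Y) {i : ι} (hi : i ∈ A) :
    0 ≤ relEnt (γ i) (avgOn A γ) :=
  relEnt_nonneg (hγ i) (avgOn_mem ⟨i, hi⟩ hγ) (avgOn_ac hγ hi)

theorem relEnt_le_jsd (hγ : ∀ i, γ i ∈ stdSimplex ℝ Y) {i : ι} (hi : i ∈ A) :
    relEnt (γ i) (avgOn A γ) ≤ jsd A γ := by
  rw [jsd_eq ⟨i, hi⟩ hγ]
  exact Finset.single_le_sum (f := fun j => relEnt (γ j) (avgOn A γ))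
    (fun j hj => relEnt_avgOn_nonneg hγ hj) hi

theorem jsd_nonneg (hA : A.Nonempty) (hγ : ∀ i, γ i ∈ stdSimplex ℝ Y) : 0 ≤ jsd A γ := by
  rw [jsd_eq hA hγ]
  exact Finset.sum_nonneg fun j hj => relEnt_avgOn_nonneg hγ hj

end functional

/-! ### Making a weak preference strict. -/

section perturb

variable {Y : Type*} [Fintype Y] {M : ℕ} {S S' : Finset (Fin M)}

/-- Measured from the old average the divergences shrink, and passing to the new average only lowers
their sum. The moved coordinates lie in `S`, so the statistic of `S` is unaffected. -/
theorem jsd_mix_lt {γ : Fin M → Y → ℝ} (hγ : ∀ i, γ i ∈ stdSimplex ℝ Y) {i₀ : Fin M}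
    (hi₀ : i₀ ∈ S \ S') (hne : γ i₀ ≠ avgOn S'ᶜ γ) {t : ℝ} (ht0 : 0 < t) (ht1 : t ≤ 1) :
    jsd S'ᶜ (fun i => if i ∈ S \ S' then (1 - t) • γ i + t • avgOn S'ᶜ γ else γ i)
      < jsd S'ᶜ γ := by
  have hi₀' : i₀ ∈ S'ᶜ := Finset.mem_compl.2 (Finset.mem_sdiff.1 hi₀).2
  have hA : S'ᶜ.Nonempty := ⟨i₀, hi₀'⟩
  set b := avgOn S'ᶜ γ with hb
  have hbm : b ∈ stdSimplex ℝ Y := avgOn_mem hA hγ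
  have hac : ∀ i ∈ S'ᶜ, ∀ a, b a = 0 → γ i a = 0 := fun i hi => avgOn_ac hγ hi
  refine (jsd_le_sum_relEnt hA (fun i => ?_) hbm fun i hi a ha => ?_).trans_lt ?_
  · split_ifs
    exacts [mix_mem (hγ i) hbm ht0.le ht1, hγ i]
  · split_ifs
    · simp [ha, hac i hi a ha]
    · exact hac i hi a ha
  · rw [jsd_eq hA hγ]
    have hnn : ∀ i ∈ S'ᶜ, 0 ≤ relEnt (γ i) b := fun i hi => relEnt_avgOn_nonneg hγ hi
    refine Finset.sum_lt_sum (fun i hi => ?_) ⟨i₀, hi₀', ?_⟩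
    · split_ifs
      · refine (relEnt_mix_le (hγ i) hbm (hac i hi) ht0.le ht1).trans ?_
        nlinarith [hnn i hi]
      · exact le_rfl
    · rw [if_pos hi₀]
      refine (relEnt_mix_le (hγ i₀) hbm (hac i₀ hi₀') ht0.le ht1).trans_lt ?_
      nlinarith [relEnt_pos (hγ i₀) hbm (hac i₀ hi₀') hne]

/-- Coordinates equal to the average b neither contribute nor shift it, so `jsd S'ᶜ γ` reduces to
`jsd K γ`, where K is the complement of the union. With b' the average over `Sᶜ`, the other side
exceeds this by |K| D(b‖b') plus the divergences of `S' \ S` from b', which cannot all vanish as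
γ_{j₀} ≠ b. -/
theorem jsd_lt_of_eq_avgOn {γ : Fin M → Y → ℝ} (hγ : ∀ i, γ i ∈ stdSimplex ℝ Y)
    (hK : (S ∪ S')ᶜ.Nonempty) (heq : ∀ i ∈ S \ S', γ i = avgOn S'ᶜ γ) {j₀ : Fin M}
    (hj₀ : j₀ ∈ S' \ S) (hne : γ j₀ ≠ avgOn S'ᶜ γ) : jsd S'ᶜ γ < jsd Sᶜ γ := by
  set K := (S ∪ S')ᶜ with hKdef
  have hKS' : S'ᶜ = K ∪ (S \ S') := by ext; simp [hKdef]; tauto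
  have hKS : Sᶜ = K ∪ (S' \ S) := by ext; simp [hKdef]; tauto
  have hd' : Disjoint K (S \ S') := by
    rw [Finset.disjoint_left]; intro a; simp [hKdef]; tauto
  have hd : Disjoint K (S' \ S) := by
    rw [Finset.disjoint_left]; intro a; simp [hKdef]; tauto
  have hKsub' : K ⊆ S'ᶜ := hKS' ▸ Finset.subset_union_left
  have hKsub : K ⊆ Sᶜ := hKS ▸ Finset.subset_union_left
  have hA' : S'ᶜ.Nonempty := hK.mono hKsub'
  have hA : Sᶜ.Nonempty := hK.mono hKsub
  set b := avgOn S'ᶜ γ with hb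
  set b' := avgOn Sᶜ γ with hb'
  have hbm : b ∈ stdSimplex ℝ Y := avgOn_mem hA' hγ
  have hbm' : b' ∈ stdSimplex ℝ Y := avgOn_mem hA hγ
  have hKb : avgOn K γ = b := by
    ext a
    have h1 := card_mul_avgOn (γ := γ) hA' a
    have h2 : ∑ k ∈ S'ᶜ, γ k a = ∑ k ∈ K, γ k a + (S \ S').card * b a := by
      rw [hKS', Finset.sum_union hd',
        Finset.sum_congr (s₁ := S \ S') rfl fun i hi => congrFun (heq i hi) a,
        Finset.sum_const, nsmul_eq_mul]
    have h3 : (S'ᶜ.card : ℝ) = K.card + (S \ S').card := by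
      rw [hKS', Finset.card_union_of_disjoint hd']
      push_cast
      rfl
    have hk : (K.card : ℝ) ≠ 0 := by exact_mod_cast hK.card_pos.ne'
    rw [avgOn, div_eq_iff hk]
    rw [← hb, h2, h3] at h1
    linarith
  have e1 : jsd S'ᶜ γ = jsd K γ := by
    rw [jsd_eq hA' hγ, ← hb, hKS', Finset.sum_union hd',
      Finset.sum_eq_zero (s := S \ S') fun i hi => by rw [heq i hi, relEnt_self], add_zero,
      jsd_eq hK hγ, hKb]
  have hacK : ∀ i ∈ K, ∀ a, b' a = 0 → γ i a = 0 := fun i hi => avgOn_ac hγ (hKsub hi)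
  have hbb' : ∀ a, b' a = 0 → b a = 0 := hKb ▸ avgOn_ac_of_ac hacK
  have hj₀S : j₀ ∈ Sᶜ := Finset.mem_compl.2 (Finset.mem_sdiff.1 hj₀).2
  have e2 : jsd Sᶜ γ = jsd K γ + K.card * relEnt b b' + ∑ j ∈ S' \ S, relEnt (γ j) b' := by
    rw [jsd_eq hA hγ, ← hb', hKS, Finset.sum_union hd, sum_relEnt_eq_jsd_add hK hγ hacK, hKb]
  have hj : relEnt (γ j₀) b' ≤ ∑ j ∈ S' \ S, relEnt (γ j) b' :=
    Finset.single_le_sum (f := fun j => relEnt (γ j) b')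
      (fun j hj => relEnt_avgOn_nonneg hγ (Finset.mem_compl.2 (Finset.mem_sdiff.1 hj).2)) hj₀
  have hkpos : (0 : ℝ) < K.card := by exact_mod_cast hK.card_pos
  have hbnn := relEnt_nonneg hbm hbm' hbb'
  have hjnn : 0 ≤ relEnt (γ j₀) b' := relEnt_avgOn_nonneg hγ hj₀S
  rw [e1, e2]
  by_cases h : b = b'
  · have := relEnt_pos (hγ j₀) hbm' (avgOn_ac hγ hj₀S) (h ▸ hne)
    nlinarith
  · have := mul_pos hkpos (relEnt_pos hbm hbm' hbb' h)
    linarith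

theorem exists_mem_Ioc_of_continuous {X : Type*} [TopologicalSpace X] {f : ℝ → X}
    (hf : Continuous f) {V : Set X} (hV : V ∈ 𝓝 (f 0)) : ∃ t, 0 < t ∧ t ≤ 1 ∧ f t ∈ V := by
  have h1 : ∀ᶠ t in 𝓝[>] (0 : ℝ), f t ∈ V := (hf.tendsto 0).mono_left nhdsWithin_le_nhds hV
  have h2 : ∀ᶠ t in 𝓝[>] (0 : ℝ), t ∈ Set.Ioc (0 : ℝ) 1 := Ioc_mem_nhdsGT one_pos
  obtain ⟨t, ht, ht'⟩ := (h1.and h2).exists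
  exact ⟨t, ht'.1, ht'.2, ht⟩

/-- The set where `S'` is preferred to `S` is, up to closure, the set where it is strictly so. -/
theorem exists_jsd_lt_near (hK : (S ∪ S')ᶜ.Nonempty) (hSS' : (S \ S').Nonempty)
    (hS'S : (S' \ S).Nonempty) [Nontrivial Y] {γ : Fin M → Y → ℝ}
    (hγ : ∀ i, γ i ∈ stdSimplex ℝ Y) (hle : jsd S'ᶜ γ ≤ jsd Sᶜ γ)
    {V : Set (Fin M → Y → ℝ)} (hV : V ∈ 𝓝 γ) :
    ∃ γ' ∈ V, (∀ i, γ' i ∈ stdSimplex ℝ Y) ∧ jsd S'ᶜ γ' < jsd Sᶜ γ' := by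
  classical
  obtain ⟨i₁, hi₁⟩ := hSS'
  have hbm : avgOn S'ᶜ γ ∈ stdSimplex ℝ Y :=
    avgOn_mem ⟨i₁, Finset.mem_compl.2 (Finset.mem_sdiff.1 hi₁).2⟩ hγ
  by_cases hcase : ∀ i ∈ S \ S', γ i = avgOn S'ᶜ γ
  · obtain ⟨j₀, hj₀⟩ := hS'S
    by_cases hj : γ j₀ = avgOn S'ᶜ γ
    -- Coordinate `j₀` lies in `S'`, so it can be moved off the average without changing the
    -- statistic of `S'`; a second pmf exists since the alphabet is nontrivial.
    · obtain ⟨e, he, hne⟩ : ∃ e ∈ stdSimplex ℝ Y, e ≠ avgOn S'ᶜ γ := by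
        obtain ⟨a, b, hab⟩ := exists_pair_ne Y
        by_cases h : Pi.single a (1 : ℝ) = avgOn S'ᶜ γ
        · refine ⟨Pi.single b 1, single_mem_stdSimplex ℝ b, fun h' => ?_⟩
          have := congrFun (h.trans h'.symm) a
          simp [hab] at this
        · exact ⟨_, single_mem_stdSimplex ℝ a, h⟩
      set f : ℝ → Fin M → Y → ℝ := fun t => Function.update γ j₀ ((1 - t) • γ j₀ + t • e) with hf
      have hfc : Continuous f := by
        rw [hf]
        exact continuous_const.update j₀ (by fun_prop)
      have hf0 : f 0 = γ := by simp [hf]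
      obtain ⟨t, ht0, ht1, htV⟩ := exists_mem_Ioc_of_continuous hfc (hf0.symm ▸ hV)
      have hagree : ∀ i ∈ S'ᶜ, f t i = γ i := fun i hi =>
        Function.update_of_ne
          (fun h : i = j₀ => Finset.mem_compl.1 hi (h ▸ (Finset.mem_sdiff.1 hj₀).1)) _ _
      have hmem : ∀ i, f t i ∈ stdSimplex ℝ Y := by
        intro i
        by_cases hi : i = j₀
        · subst hi
          simpa [hf] using mix_mem (hγ i) he ht0.le ht1
        · simpa [hf, hi] using hγ i
      refine ⟨f t, htV, hmem, jsd_lt_of_eq_avgOn hmem hK (fun i hi => ?_) hj₀ ?_⟩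
      · rw [avgOn_congr hagree, hagree i (Finset.mem_compl.2 (Finset.mem_sdiff.1 hi).2)]
        exact hcase i hi
      · rw [avgOn_congr hagree]
        intro h
        have h' : (1 - t) • avgOn S'ᶜ γ + t • e = avgOn S'ᶜ γ := by simpa [hf, hj] using h
        refine hne (smul_right_injective _ ht0.ne' ?_)
        have : t • e = avgOn S'ᶜ γ - (1 - t) • avgOn S'ᶜ γ := eq_sub_of_add_eq' h'
        simp only [this, sub_smul, one_smul, sub_sub_cancel]
    · exact ⟨γ, mem_of_mem_nhds hV, hγ, jsd_lt_of_eq_avgOn hγ hK hcase hj₀ hj⟩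
  · push Not at hcase
    obtain ⟨i₀, hi₀, hne⟩ := hcase
    set f : ℝ → Fin M → Y → ℝ := fun t i =>
      if i ∈ S \ S' then (1 - t) • γ i + t • avgOn S'ᶜ γ else γ i with hf
    have hfc : Continuous f := by
      refine continuous_pi fun i => ?_
      by_cases hi : i ∈ S \ S'
      · simp only [hf, if_pos hi]
        fun_prop
      · simp only [hf, if_neg hi]
        fun_prop
    have hf0 : f 0 = γ := by
      ext i
      simp [hf]
    obtain ⟨t, ht0, ht1, htV⟩ := exists_mem_Ioc_of_continuous hfc (hf0.symm ▸ hV)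
    refine ⟨f t, htV, fun i => ?_, ?_⟩
    · simp only [hf]
      split_ifs
      exacts [mix_mem (hγ i) hbm ht0.le ht1, hγ i]
    · refine (jsd_mix_lt hγ hi₀ hne ht0 ht1).trans_le (hle.trans_eq (jsd_congr fun i hi => ?_))
      have : i ∉ S \ S' := fun h => Finset.mem_compl.1 hi (Finset.mem_sdiff.1 h).1
      simp only [hf, if_neg this]

theorem mix_full {q r : Y → ℝ} (hq : q ∈ stdSimplex ℝ Y) (hr : FullPmf r) {t : ℝ} (ht0 : 0 < t)
    (ht1 : t ≤ 1) : FullPmf ((1 - t) • q + t • r) := by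
  refine ⟨mix_mem hq hr.mem ht0.le ht1, fun a => ?_⟩
  have := mul_pos ht0 (hr.pos a)
  have := mul_nonneg (sub_nonneg.2 ht1) (hq.1 a)
  simp only [Pi.add_apply, Pi.smul_apply, smul_eq_mul]
  linarith

theorem exists_full_near {π : Y → ℝ} (hπ : FullPmf π) {γ : Fin M → Y → ℝ}
    (hγ : ∀ i, γ i ∈ stdSimplex ℝ Y) {V : Set (Fin M → Y → ℝ)} (hV : V ∈ 𝓝 γ) :
    ∃ γ' ∈ V, ∀ i, FullPmf (γ' i) := by
  set f : ℝ → Fin M → Y → ℝ := fun t i => (1 - t) • γ i + t • π with hf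
  have hfc : Continuous f := by fun_prop
  have hf0 : f 0 = γ := by
    ext i
    simp [hf]
  obtain ⟨t, ht0, ht1, htV⟩ := exists_mem_Ioc_of_continuous hfc (hf0.symm ▸ hV)
  exact ⟨f t, htV, fun i => mix_full (hγ i) hπ ht0 ht1⟩

end perturb

/-! ### Sets of `T` coordinates. -/

section sets

variable {M T : ℕ}

theorem card_compl_of_card {S : Finset (Fin M)} (hS : S.card = T) :
    ((Sᶜ).card : ℝ) = (M : ℝ) - T := by
  have : S.card ≤ M := (Finset.card_le_univ S).trans (Fintype.card_fin M).le
  rw [Finset.card_compl, Fintype.card_fin, hS, Nat.cast_sub (hS ▸ this)]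

theorem compl_nonempty_of_card (hTM : T < M) {S : Finset (Fin M)} (hS : S.card = T) :
    Sᶜ.Nonempty := by
  rw [← Finset.card_pos, Finset.card_compl, Fintype.card_fin, hS]
  omega

theorem sdiff_nonempty_of_card {S S' : Finset (Fin M)} (hS : S.card = T) (hS' : S'.card = T)
    (hne : S ≠ S') : (S \ S').Nonempty :=
  Finset.sdiff_nonempty.2 fun h => hne (Finset.eq_of_subset_of_card_le h (hS'.trans hS.symm).le)

/-- Two sets of `T` coordinates that differ only in `i` and `j`. -/
theorem exists_swap (hT : 0 < T) (hTM : T < M) {i j : Fin M} (hij : i ≠ j) :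
    ∃ R : Finset (Fin M), i ∉ R ∧ j ∉ R ∧ (insert i R).card = T ∧ (insert j R).card = T := by
  obtain ⟨R, hR, hRc⟩ := Finset.exists_subset_card_eq
    (s := ({i, j} : Finset (Fin M))ᶜ) (n := T - 1)
    (by rw [Finset.card_compl, Fintype.card_fin, Finset.card_pair hij]; omega)
  have hi : i ∉ R := fun h => by simpa using hR h
  have hj : j ∉ R := fun h => by simpa using hR h
  refine ⟨R, hi, hj, ?_, ?_⟩
  · rw [Finset.card_insert_of_notMem hi, hRc]; omega
  · rw [Finset.card_insert_of_notMem hj, hRc]; omega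

theorem sum_compl_insert {i : Fin M} {R : Finset (Fin M)} (hi : i ∉ R) (f : Fin M → ℝ) :
    ∑ k ∈ (insert i R)ᶜ, f k = ∑ k, f k - ∑ k ∈ R, f k - f i := by
  have := Finset.sum_compl_add_sum (insert i R) f
  rw [Finset.sum_insert hi] at this
  linarith

end sets

/-! ### The exponent of the universal test as a least cost of confusion. -/

section exponent

variable {Y : Type*} [Fintype Y] {M T : ℕ}

theorem jsd_insert_eq {i j : Fin M} {R : Finset (Fin M)} (hi : i ∉ R) (hj : j ∉ R)
    {γ : Fin M → Y → ℝ} (h : γ i = γ j) : jsd (insert i R)ᶜ γ = jsd (insert j R)ᶜ γ := by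
  have hc : (insert i R)ᶜ.card = (insert j R)ᶜ.card := by
    rw [Finset.card_compl, Finset.card_compl, Finset.card_insert_of_notMem hi,
      Finset.card_insert_of_notMem hj]
  have ha : avgOn (insert i R)ᶜ γ = avgOn (insert j R)ᶜ γ := by
    ext a
    rw [avgOn, avgOn, hc, sum_compl_insert hi, sum_compl_insert hj, h]
  rw [jsd, jsd, hc, ha, sum_compl_insert hi, sum_compl_insert hj, h]

theorem cost_law (μ : Fin M → Y → ℝ) (π : Y → ℝ) (S : Finset (Fin M)) (γ : Fin M → Y → ℝ) :
    cost (law μ π S) γ = ∑ i ∈ S, relEnt (γ i) (μ i) + ∑ i ∈ Sᶜ, relEnt (γ i) π := by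
  rw [cost, ← Finset.sum_add_sum_compl S]
  congr 1
  · exact Finset.sum_congr rfl fun i hi => by rw [law, if_pos hi]
  · exact Finset.sum_congr rfl fun i hi => by rw [law, if_neg (Finset.mem_compl.1 hi)]

theorem add_sum_compl_le_cost {μ : Fin M → Y → ℝ} {π : Y → ℝ} (hμ : ∀ i, FullPmf (μ i))
    {S : Finset (Fin M)} {γ : Fin M → Y → ℝ} (hγ : ∀ i, γ i ∈ stdSimplex ℝ Y) {i : Fin M}
    (hi : i ∈ S) : relEnt (γ i) (μ i) + ∑ j ∈ Sᶜ, relEnt (γ j) π ≤ cost (law μ π S) γ := by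
  rw [cost_law]
  gcongr
  exact Finset.single_le_sum (f := fun i => relEnt (γ i) (μ i))
    (fun j _ => relEnt_nonneg (hγ j) (hμ j).mem ((hμ j).ac _)) hi

/-- The laws of the coordinates under `insert i R`, with those of `i` and `j` replaced. -/
noncomputable def pairLaw (μ : Fin M → Y → ℝ) (π : Y → ℝ) (R : Finset (Fin M)) (i j : Fin M)
    (ν ν' : Y → ℝ) (k : Fin M) : Y → ℝ :=
  if k = i then ν else if k = j then ν' else law μ π R k

omit [Fintype Y] in
theorem pairLaw_left (μ : Fin M → Y → ℝ) (π : Y → ℝ) (R : Finset (Fin M)) (i j : Fin M)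
    (ν ν' : Y → ℝ) : pairLaw μ π R i j ν ν' i = ν := if_pos rfl

omit [Fintype Y] in
theorem pairLaw_right (μ : Fin M → Y → ℝ) (π : Y → ℝ) (R : Finset (Fin M)) {i j : Fin M}
    (hij : i ≠ j) (ν ν' : Y → ℝ) : pairLaw μ π R i j ν ν' j = ν' := by
  rw [pairLaw, if_neg hij.symm, if_pos rfl]

theorem pairLaw_full {μ : Fin M → Y → ℝ} {π : Y → ℝ} (hμ : ∀ i, FullPmf (μ i))
    (hπ : FullPmf π) (R : Finset (Fin M)) (i j : Fin M) {ν ν' : Y → ℝ} (hν : FullPmf ν)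
    (hν' : FullPmf ν') (k : Fin M) : FullPmf (pairLaw μ π R i j ν ν' k) := by
  rw [pairLaw]
  split_ifs
  exacts [hν, hν', law_full hμ hπ R k]

theorem cost_pairLaw_left (μ : Fin M → Y → ℝ) (π : Y → ℝ) {R : Finset (Fin M)} {i j : Fin M}
    (hij : i ≠ j) (hj : j ∉ R) (ν ν' : Y → ℝ) :
    cost (law μ π (insert i R)) (pairLaw μ π R i j ν ν') = relEnt ν (μ i) + relEnt ν' π := by
  rw [cost, Finset.sum_eq_add i j hij (fun k _ hk => ?_) (by simp) (by simp), pairLaw_left,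
    pairLaw_right _ _ _ hij, law, if_pos (Finset.mem_insert_self i R), law,
    if_neg (by simp [hij.symm, hj])]
  have : law μ π (insert i R) k = law μ π R k := by simp [law, hk.1]
  rw [pairLaw, if_neg hk.1, if_neg hk.2, this, relEnt_self]

theorem cost_pairLaw_right (μ : Fin M → Y → ℝ) (π : Y → ℝ) {R : Finset (Fin M)} {i j : Fin M}
    (hij : i ≠ j) (hi : i ∉ R) (ν ν' : Y → ℝ) :
    cost (law μ π (insert j R)) (pairLaw μ π R i j ν ν') = relEnt ν π + relEnt ν' (μ j) := by
  rw [cost, Finset.sum_eq_add i j hij (fun k _ hk => ?_) (by simp) (by simp), pairLaw_left,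
    pairLaw_right _ _ _ hij, law, if_neg (by simp [hij, hi]), law,
    if_pos (Finset.mem_insert_self j R)]
  have : law μ π (insert j R) k = law μ π R k := by simp [law, hk.2]
  rw [pairLaw, if_neg hk.1, if_neg hk.2, this, relEnt_self]

/-- The pairs of sets and the families of pmfs at which the universal test may prefer `S'` to
`S`. -/
structure Confusable (T : ℕ) (S S' : Finset (Fin M)) (γ : Fin M → Y → ℝ) : Prop where
  left : S.card = T
  right : S'.card = T
  ne : S ≠ S'
  mem : ∀ i, γ i ∈ stdSimplex ℝ Y
  le : jsd S'ᶜ γ ≤ jsd Sᶜ γ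

/-- For each of the finitely many pairs of sets the confusable families form a compact set, on which
the continuous cost has a minimum. -/
theorem exists_confusable_min {μ : Fin M → Y → ℝ} {π : Y → ℝ} (hT : 0 < T) (hTM : T < M)
    (hμ : ∀ i, FullPmf (μ i)) (hπ : FullPmf π) :
    ∃ S S' γ, Confusable T S S' γ ∧ ∀ R R' τ, Confusable T R R' τ →
      cost (law μ π S) γ ≤ cost (law μ π R) τ := by
  classical
  set C : Finset (Fin M) × Finset (Fin M) → Set (Fin M → Y → ℝ) :=
    fun p => {γ | Confusable T p.1 p.2 γ} with hC
  set P : Finset (Finset (Fin M) × Finset (Fin M)) := Finset.univ.filter fun p => (C p).Nonempty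
    with hP
  have hcompact : ∀ p ∈ P, IsCompact (C p) := by
    intro p hp
    obtain ⟨τ, hτ⟩ := (Finset.mem_filter.1 hp).2
    have hsimp : IsCompact (Set.univ.pi fun _ : Fin M => stdSimplex ℝ Y) :=
      isCompact_univ_pi fun _ => isCompact_stdSimplex ℝ Y
    have : C p = (Set.univ.pi fun _ : Fin M => stdSimplex ℝ Y)
        ∩ {γ | jsd p.2ᶜ γ ≤ jsd p.1ᶜ γ} := by
      ext γ
      exact ⟨fun h => ⟨fun i _ => h.mem i, h.le⟩,
        fun h => ⟨hτ.left, hτ.right, hτ.ne, fun i => h.1 i trivial, h.2⟩⟩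
    rw [this]
    exact hsimp.inter_right (isClosed_le (continuous_jsd _) (continuous_jsd _))
  have hmin : ∀ p ∈ P, ∃ γ ∈ C p, IsMinOn (cost (law μ π p.1)) (C p) γ := fun p hp =>
    (hcompact p hp).exists_isMinOn (Finset.mem_filter.1 hp).2
      (continuous_cost (law_full hμ hπ p.1)).continuousOn
  choose! g hg hgmin using hmin
  -- With every coordinate equal to π, any two sets tie.
  have hPne : P.Nonempty := by
    obtain ⟨i, j, hij⟩ : ∃ i j : Fin M, i ≠ j :=
      ⟨⟨0, by omega⟩, ⟨1, by omega⟩, by simp⟩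
    obtain ⟨R, hi, hj, hci, hcj⟩ := exists_swap hT hTM hij
    refine ⟨(insert i R, insert j R), Finset.mem_filter.2 ⟨Finset.mem_univ _, fun _ => π, hci, hcj,
      fun h => ?_, fun _ => hπ.mem, (jsd_insert_eq hj hi rfl).le⟩⟩
    have h' : insert i R = insert j R := h
    have : i ∈ insert j R := h' ▸ Finset.mem_insert_self i R
    exact (Finset.mem_insert.1 this).elim hij hi
  obtain ⟨p, hp, hpmin⟩ := P.exists_min_image (fun p => cost (law μ π p.1) (g p)) hPne
  refine ⟨p.1, p.2, g p, hg p hp, fun R R' τ h => ?_⟩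
  have hR : (R, R') ∈ P := Finset.mem_filter.2 ⟨Finset.mem_univ _, τ, h⟩
  exact (hpmin _ hR).trans (hgmin _ hR h)

theorem HasErrorExponent.le {d : Rule Y M} {μ : Fin M → Y → ℝ} {π : Y → ℝ} {a c : ℝ}
    (h : HasErrorExponent T d μ π a)
    (hc : ∀ᶠ n : ℕ in atTop, Real.exp (-(n * c)) ≤ maxError T d μ π n) : a ≤ c := by
  refine le_of_tendsto h ?_
  filter_upwards [eventually_gt_atTop 0, hc] with n hn h2
  have hn' : (0 : ℝ) < n := by exact_mod_cast hn
  have h3 := Real.log_le_log (Real.exp_pos _) h2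
  rw [Real.log_exp] at h3
  rw [neg_mul, one_div, ← div_eq_inv_mul, neg_le, le_div_iff₀ hn']
  linarith

variable [DecidableEq Y]

theorem statUniv_eq_jsd {n : ℕ} (hn : 0 < n) (hTM : T < M) (y : Data Y M n)
    {S : Finset (Fin M)} (hS : S.card = T) : statUniv T y S = jsd Sᶜ (emp y) := by
  have h : avgEmpirical T y S = avgOn Sᶜ (emp y) := by
    ext a
    rw [avgEmpirical, avgOn, card_compl_of_card hS]
    rfl
  have hmem : ∀ i, emp y i ∈ stdSimplex ℝ Y := fun i => empirical_mem hn (y i)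
  rw [jsd_eq (compl_nonempty_of_card hTM hS) hmem, statUniv, h]
  rfl

omit [DecidableEq Y] in
theorem nontrivial_of_full_ne {p q : Y → ℝ} (hp : FullPmf p) (hq : FullPmf q) (h : p ≠ q) :
    Nontrivial Y := by
  by_contra hY
  rw [not_nontrivial_iff_subsingleton] at hY
  obtain ⟨a⟩ := nonempty_of_pmf hp.mem
  refine h (funext fun b => ?_)
  have h1 := hp.mem.2
  have h2 := hq.mem.2
  rw [Fintype.sum_subsingleton _ b] at h1 h2
  rw [h1, h2]

/-- The error exponent of the universal test is the least cost of confusion. -/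
theorem exists_hasErrorExponent_univ {μ : Fin M → Y → ℝ} {π : Y → ℝ} (hT : 0 < T)
    (hTM : 2 * T < M) (hμ : ∀ i, FullPmf (μ i)) (hπ : FullPmf π) (hne : ∀ i, μ i ≠ π)
    {d : Rule Y M} (hd : IsUnivTest T d) :
    ∃ S S' γ, Confusable T S S' γ ∧ (∀ R R' τ, Confusable T R R' τ →
      cost (law μ π S) γ ≤ cost (law μ π R) τ) ∧
      HasErrorExponent T d μ π (cost (law μ π S) γ) := by
  have hTM' : T < M := by omega
  have : Nontrivial Y := nontrivial_of_full_ne (hμ ⟨0, by omega⟩) hπ (hne _)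
  obtain ⟨S, S', γ, hc, hmin⟩ := exists_confusable_min hT hTM' hμ hπ
  refine ⟨S, S', γ, hc, hmin, hasErrorExponent_of_cost hμ hπ ⟨S, hc.left⟩ ?_ ?_⟩
  · intro R hR n hn y hy
    refine hmin R (d n y) (emp y) ⟨hR, (hd n y).1, hy.symm, fun i => empirical_mem hn (y i), ?_⟩
    rw [← statUniv_eq_jsd hn hTM' y hR, ← statUniv_eq_jsd hn hTM' y (hd n y).1]
    exact (hd n y).2 R hR
  · intro c hcE
    -- This is where M > 2T enters: some coordinate lies outside both sets.
    have hK : (S ∪ S')ᶜ.Nonempty := by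
      rw [← Finset.card_pos, Finset.card_compl, Fintype.card_fin]
      have := Finset.card_union_le S S'
      have := hc.left
      have := hc.right
      omega
    have hV : {τ | cost (law μ π S) τ < c} ∈ 𝓝 γ :=
      (isOpen_lt (continuous_cost (law_full hμ hπ S)) continuous_const).mem_nhds hcE
    obtain ⟨γ₁, hγ₁V, hγ₁, hlt₁⟩ := exists_jsd_lt_near hK
      (sdiff_nonempty_of_card hc.left hc.right hc.ne)
      (sdiff_nonempty_of_card hc.right hc.left hc.ne.symm) hc.mem hc.le hV
    have hopen : IsOpen {τ : Fin M → Y → ℝ | jsd S'ᶜ τ < jsd Sᶜ τ} :=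
      isOpen_lt (continuous_jsd _) (continuous_jsd _)
    obtain ⟨γ₂, hγ₂V, hγ₂⟩ := exists_full_near hπ hγ₁ (inter_mem
      ((isOpen_lt (continuous_cost (law_full hμ hπ S)) continuous_const).mem_nhds hγ₁V)
      (hopen.mem_nhds hlt₁))
    -- Both sets are taken to be `S`: near γ₂ the test strictly prefers `S'`, so it always misses
    -- `S`.
    refine exp_le_maxError d hμ hπ hc.left hc.left hγ₂ (hopen.mem_nhds hγ₂V.2)
      (fun n hn y hy => or_self_iff.2 fun h => ?_) hγ₂V.1 hγ₂V.1
    have h1 := (hd n y).2 S' hc.right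
    rw [h, statUniv_eq_jsd hn hTM' y hc.left, statUniv_eq_jsd hn hTM' y hc.right] at h1
    exact absurd hy (not_lt.2 h1)

end exponent

/-! ### Chernoff information. -/

section chernoff

variable {Y : Type*} [Fintype Y]

theorem rpow_sum_pos {p q : Y → ℝ} (hp : FullPmf p) (hq : FullPmf q) (s t : ℝ) :
    0 < ∑ y, p y ^ s * q y ^ t := by
  obtain ⟨a⟩ := nonempty_of_pmf hp.mem
  exact Finset.sum_pos (fun y _ => mul_pos (Real.rpow_pos_of_pos (hp.pos y) _)
    (Real.rpow_pos_of_pos (hq.pos y) _)) ⟨a, Finset.mem_univ a⟩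

/-- The exponential family joining two pmfs. -/
theorem exists_tilt {p q : Y → ℝ} (hp : FullPmf p) (hq : FullPmf q) (c : ℝ) :
    ∃ (ν : Y → ℝ) (a : ℝ), FullPmf ν ∧
      HasDerivAt (fun s => Real.log (∑ y, p y ^ s * q y ^ (1 - s))) a c ∧
      relEnt ν p = -(1 - c) * a - Real.log (∑ y, p y ^ c * q y ^ (1 - c)) ∧
      relEnt ν q = c * a - Real.log (∑ y, p y ^ c * q y ^ (1 - c)) := by
  have hZ := rpow_sum_pos hp hq c (1 - c)
  set Z := ∑ y, p y ^ c * q y ^ (1 - c) with hZdef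
  set ν : Y → ℝ := fun y => p y ^ c * q y ^ (1 - c) / Z with hν
  have hpos : ∀ y, 0 < ν y := fun y => div_pos (mul_pos (Real.rpow_pos_of_pos (hp.pos y) _)
    (Real.rpow_pos_of_pos (hq.pos y) _)) hZ
  have hsum : ∑ y, ν y = 1 := by
    rw [hν, ← Finset.sum_div, div_self hZ.ne']
  have hlog : ∀ y, Real.log (ν y)
      = c * Real.log (p y) + (1 - c) * Real.log (q y) - Real.log Z := by
    intro y
    rw [hν]
    dsimp only
    rw [Real.log_div (mul_pos (Real.rpow_pos_of_pos (hp.pos y) _)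
      (Real.rpow_pos_of_pos (hq.pos y) _)).ne' hZ.ne',
      Real.log_mul (Real.rpow_pos_of_pos (hp.pos y) _).ne'
      (Real.rpow_pos_of_pos (hq.pos y) _).ne', Real.log_rpow (hp.pos y), Real.log_rpow (hq.pos y)]
  refine ⟨ν, ∑ y, ν y * (Real.log (p y) - Real.log (q y)),
    -- The derivative of the log-normalizer is the mean log-likelihood ratio under the tilted law.
    ⟨⟨fun y => (hpos y).le, hsum⟩, hpos⟩, ?_, ?_, ?_⟩
  · have hd : ∀ y ∈ Finset.univ, HasDerivAt (fun s => p y ^ s * q y ^ (1 - s))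
        (p y ^ c * q y ^ (1 - c) * (Real.log (p y) - Real.log (q y))) c := by
      intro y _
      have h1 := (hasDerivAt_id c).const_rpow (a := p y) (hp.pos y)
      have h2 := ((hasDerivAt_id c).const_sub 1).const_rpow (a := q y) (hq.pos y)
      refine (h1.mul h2).congr_deriv ?_
      simp only [id]
      ring
    refine ((HasDerivAt.fun_sum hd).log hZ.ne').congr_deriv ?_
    rw [← hZdef, Finset.sum_div]
    exact Finset.sum_congr rfl fun y _ => by rw [hν]; ring
  · have : ∀ y, ν y * Real.log (ν y / p y)
        = -(1 - c) * (ν y * (Real.log (p y) - Real.log (q y))) - ν y * Real.log Z := by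
      intro y
      rw [Real.log_div (hpos y).ne' (hp.pos y).ne', hlog]
      ring
    rw [relEnt, Finset.sum_congr rfl fun y _ => this y, Finset.sum_sub_distrib, ← Finset.mul_sum,
      ← Finset.sum_mul, hsum, one_mul]
  · have : ∀ y, ν y * Real.log (ν y / q y)
        = c * (ν y * (Real.log (p y) - Real.log (q y))) - ν y * Real.log Z := by
      intro y
      rw [Real.log_div (hpos y).ne' (hq.pos y).ne', hlog]
      ring
    rw [relEnt, Finset.sum_congr rfl fun y _ => this y, Finset.sum_sub_distrib, ← Finset.mul_sum,
      ← Finset.sum_mul, hsum, one_mul]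

/-- Continuity on the compact interval bounds the family, so the real supremum is genuine. -/
theorem le_chernoff {p q : Y → ℝ} (hp : ∀ y, 0 < p y) (hq : ∀ y, 0 < q y) [Nonempty Y]
    {s : ℝ} (hs : s ∈ Set.Icc (0 : ℝ) 1) :
    -Real.log (∑ y, p y ^ s * q y ^ (1 - s)) ≤ chernoff p q := by
  have hpos : ∀ s : ℝ, 0 < ∑ y, p y ^ s * q y ^ (1 - s) := fun s =>
    Finset.sum_pos (fun y _ => mul_pos (Real.rpow_pos_of_pos (hp y) _)
      (Real.rpow_pos_of_pos (hq y) _)) Finset.univ_nonempty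
  have hc : Continuous fun s : Set.Icc (0 : ℝ) 1 =>
      -Real.log (∑ y, p y ^ (s : ℝ) * q y ^ (1 - (s : ℝ))) := by
    have hs : Continuous fun s : Set.Icc (0 : ℝ) 1 =>
        ∑ y, p y ^ (s : ℝ) * q y ^ (1 - (s : ℝ)) := by
      refine continuous_finsetSum _ fun y _ => ?_
      exact ((Real.continuous_const_rpow (hp y).ne').comp continuous_subtype_val).mul
        ((Real.continuous_const_rpow (hq y).ne').comp (continuous_const.sub continuous_subtype_val))
    exact (hs.log fun s => (hpos s).ne').neg
  exact le_ciSup (isCompact_range hc).bddAbove ⟨s, hs⟩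

theorem sum_pair_rpow {p p' q : Y → ℝ} (hp : FullPmf p) (hp' : FullPmf p') (hq : FullPmf q)
    (s : ℝ) :
    ∑ z : Y × Y, (p z.1 * q z.2) ^ s * (q z.1 * p' z.2) ^ (1 - s)
      = (∑ y, p y ^ s * q y ^ (1 - s)) * ∑ y, q y ^ s * p' y ^ (1 - s) := by
  rw [Fintype.sum_prod_type, Finset.sum_mul_sum]
  refine Finset.sum_congr rfl fun a _ => Finset.sum_congr rfl fun b _ => ?_
  rw [Real.mul_rpow (hp.pos a).le (hq.pos b).le, Real.mul_rpow (hq.pos a).le (hp'.pos b).le]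
  ring

theorem le_chernoff_pair {p p' q : Y → ℝ} (hp : FullPmf p) (hp' : FullPmf p') (hq : FullPmf q)
    {s : ℝ} (hs : s ∈ Set.Icc (0 : ℝ) 1) :
    -(Real.log (∑ y, p y ^ s * q y ^ (1 - s)) + Real.log (∑ y, q y ^ s * p' y ^ (1 - s)))
      ≤ chernoff (fun z : Y × Y => p z.1 * q z.2) (fun z : Y × Y => q z.1 * p' z.2) := by
  have : Nonempty Y := nonempty_of_pmf hp.mem
  have h := le_chernoff (p := fun z : Y × Y => p z.1 * q z.2)
    (q := fun z : Y × Y => q z.1 * p' z.2) (fun z => mul_pos (hp.pos _) (hq.pos _))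
    (fun z => mul_pos (hq.pos _) (hp'.pos _)) hs
  rwa [sum_pair_rpow hp hp' hq, Real.log_mul (rpow_sum_pos hp hq _ _).ne'
    (rpow_sum_pos hq hp' _ _).ne'] at h

/-- Two laws equidistant from both hypotheses, at distance at most the Chernoff information. -/
theorem exists_pair_le_chernoff {p p' q : Y → ℝ} (hp : FullPmf p) (hp' : FullPmf p')
    (hq : FullPmf q) : ∃ ν ν' : Y → ℝ, FullPmf ν ∧ FullPmf ν' ∧
      relEnt ν p + relEnt ν' q
        ≤ chernoff (fun z : Y × Y => p z.1 * q z.2) (fun z : Y × Y => q z.1 * p' z.2) ∧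
      relEnt ν q + relEnt ν' p'
        ≤ chernoff (fun z : Y × Y => p z.1 * q z.2) (fun z : Y × Y => q z.1 * p' z.2) := by
  choose ν a hν hda hνp hνq using fun c => exists_tilt hp hq c
  choose ν' b hν' hdb hνq' hνp' using fun c => exists_tilt hq hp' c
  have hderiv := fun c => (hda c).add (hdb c)
  -- The sum of the two log-normalizers vanishes at 0 and 1. At a critical point given by Rolle the
  -- two derivatives are opposite, so they cancel in both sums of divergences, leaving minus the
  -- log-normalizers.
  obtain ⟨c, hc, hzero⟩ := exists_hasDerivAt_eq_zero (f := fun s =>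
      Real.log (∑ y, p y ^ s * q y ^ (1 - s)) + Real.log (∑ y, q y ^ s * p' y ^ (1 - s)))
    (f' := fun c => a c + b c) (zero_lt_one' ℝ)
    (fun c _ => (hderiv c).continuousAt.continuousWithinAt)
    (by simp [hp.mem.2, hq.mem.2, hp'.mem.2]) (fun c _ => hderiv c)
  have hle := le_chernoff_pair hp hp' hq (Set.Ioo_subset_Icc_self hc)
  have hb : b c = -a c := by linarith
  refine ⟨ν c, ν' c, hν c, hν' c, ?_, ?_⟩
  · rw [hνp, hνq', hb]
    linarith
  · rw [hνq, hνp', hb]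
    linarith

theorem chernoff_pair_nonneg {p p' q : Y → ℝ} (hp : FullPmf p) (hp' : FullPmf p')
    (hq : FullPmf q) :
    0 ≤ chernoff (fun z : Y × Y => p z.1 * q z.2) (fun z : Y × Y => q z.1 * p' z.2) := by
  have := le_chernoff_pair hp hp' hq (s := 0) (by simp)
  simpa [hq.mem.2, hp'.mem.2] using this

/-- The sum for the product laws splits into two factors, and each is at least κ^t for some t in [0,
1], hence at least κ. -/
theorem chernoff_pair_le {p p' q : Y → ℝ} (hp : FullPmf p) (hp' : FullPmf p') (hq : FullPmf q)
    {κ : ℝ} (hκ0 : 0 < κ) (hκ1 : κ ≤ 1) (h : ∀ y, κ * q y ≤ p y) (h' : ∀ y, κ * q y ≤ p' y) :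
    chernoff (fun z : Y × Y => p z.1 * q z.2) (fun z : Y × Y => q z.1 * p' z.2)
      ≤ -2 * Real.log κ := by
  refine ciSup_le fun s => ?_
  obtain ⟨s, hs0, hs1⟩ := s
  have key : ∀ (r : Y → ℝ) (t : ℝ), FullPmf r → (∀ y, κ * q y ≤ r y) → 0 ≤ t → t ≤ 1 →
      κ ≤ ∑ y, r y ^ t * q y ^ (1 - t) := by
    intro r t hr hrq ht0 ht1
    calc κ = ∑ y, κ * q y := by rw [← Finset.mul_sum, hq.mem.2, mul_one]
      _ ≤ ∑ y, r y ^ t * q y ^ (1 - t) := by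
        refine Finset.sum_le_sum fun y _ => ?_
        have hqy := hq.pos y
        calc κ * q y ≤ κ ^ t * q y := by
              gcongr
              exact Real.self_le_rpow_of_le_one hκ0.le hκ1 ht1
          _ = (κ * q y) ^ t * q y ^ (1 - t) := by
              rw [Real.mul_rpow hκ0.le hqy.le, mul_assoc, ← Real.rpow_add hqy,
                add_sub_cancel, Real.rpow_one]
          _ ≤ _ := by
              have := hrq y
              gcongr
  have h1 := Real.log_le_log hκ0 (key p s hp h hs0 hs1)
  have h2 := Real.log_le_log hκ0 (key p' (1 - s) hp' h' (by linarith) (by linarith))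
  have hcomm : ∑ y, p' y ^ (1 - s) * q y ^ (1 - (1 - s)) = ∑ y, q y ^ s * p' y ^ (1 - s) :=
    Finset.sum_congr rfl fun y _ => by rw [sub_sub_cancel, mul_comm]
  rw [hcomm] at h2
  dsimp only
  rw [sum_pair_rpow hp hp' hq, Real.log_mul (rpow_sum_pos hp hq _ _).ne'
    (rpow_sum_pos hq hp' _ _).ne']
  linarith

/-- Since -log Z ≥ 1 - Z, B is at least half the squared Hellinger distance, and one letter with μ <
κπ already contributes at least π(1 - √κ)² to the latter. With `chernoff_pair_le`, this turns small
Bhattacharyya distances into small Chernoff information. -/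
theorem exists_bhatt_lt_imp_le {π : Y → ℝ} (hπ : FullPmf π) {κ : ℝ} (hκ0 : 0 < κ) (hκ1 : κ < 1) :
    ∃ ε > 0, ∀ μ : Y → ℝ, FullPmf μ → bhatt μ π < ε → ∀ y, κ * π y ≤ μ y := by
  have hsκ : √κ < 1 := by rw [Real.sqrt_lt' one_pos]; linarith
  have hpos : 0 < Real.exp (-cConst π) * (1 - √κ) ^ 2 / 2 := by
    have := sub_pos.2 hsκ
    positivity
  refine ⟨_, hpos, fun μ hμ hlt y => ?_⟩
  by_contra! hy
  have hZ := sum_sqrt_pos hμ hπ.mem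
  have h1 : ∑ a, (√(μ a) - √(π a)) ^ 2 = 2 - 2 * ∑ a, √(μ a) * √(π a) := by
    have : ∀ a, (√(μ a) - √(π a)) ^ 2 = μ a + π a - 2 * (√(μ a) * √(π a)) := by
      intro a
      have := Real.sq_sqrt (hμ.pos a).le
      have := Real.sq_sqrt (hπ.pos a).le
      linarith [sub_sq (√(μ a)) (√(π a))]
    rw [Finset.sum_congr rfl fun a _ => this a, Finset.sum_sub_distrib, Finset.sum_add_distrib,
      hμ.mem.2, hπ.mem.2, ← Finset.mul_sum]
    ring
  have h2 : (√(μ y) - √(π y)) ^ 2 ≤ ∑ a, (√(μ a) - √(π a)) ^ 2 :=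
    Finset.single_le_sum (f := fun a => (√(μ a) - √(π a)) ^ 2) (fun _ _ => sq_nonneg _)
      (Finset.mem_univ y)
  have h3 := Real.log_le_sub_one_of_pos hZ
  have h4 : √(μ y) ≤ √κ * √(π y) := by
    rw [← Real.sqrt_mul hκ0.le]
    exact Real.sqrt_le_sqrt hy.le
  have h5 : Real.exp (-cConst π) ≤ π y := by
    rw [← Real.exp_log (hπ.pos y)]
    exact Real.exp_le_exp.2 (by linarith [le_cConst hπ y])
  have h6 : π y * (1 - √κ) ^ 2 ≤ (√(μ y) - √(π y)) ^ 2 := by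
    have e : π y * (1 - √κ) ^ 2 = (√(π y) * (1 - √κ)) ^ 2 := by
      rw [mul_pow, Real.sq_sqrt (hπ.pos y).le]
    rw [e, ← neg_sq (√(μ y) - √(π y))]
    refine pow_le_pow_left₀ (mul_nonneg (Real.sqrt_nonneg _) (sub_pos.2 hsκ).le) ?_ 2
    linarith
  have h7 := mul_le_mul_of_nonneg_right h5 (sq_nonneg (1 - √κ))
  rw [bhatt] at hlt
  linarith

end chernoff

/-! ### The converse for arbitrary tests. -/

section converse

variable {Y : Type*} [Fintype Y] [DecidableEq Y] {M T : ℕ}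

/-- A converse for every test, from a pair of laws of two coordinates. -/
theorem exp_le_maxError_of_pair (hT : 0 < T) (hTM : T < M) (d : Rule Y M) {μ : Fin M → Y → ℝ}
    {π : Y → ℝ} (hμ : ∀ i, FullPmf (μ i)) (hπ : FullPmf π) {i j : Fin M} (hij : i ≠ j)
    {ν ν' : Y → ℝ} (hν : FullPmf ν) (hν' : FullPmf ν') {c : ℝ}
    (h : relEnt ν (μ i) + relEnt ν' π < c) (h' : relEnt ν π + relEnt ν' (μ j) < c) :
    ∀ᶠ n : ℕ in atTop, Real.exp (-(n * c)) ≤ maxError T d μ π n := by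
  obtain ⟨R, hi, hj, hci, hcj⟩ := exists_swap hT hTM hij
  refine exp_le_maxError d hμ hπ hci hcj (pairLaw_full hμ hπ R i j hν hν') univ_mem
    (fun n _ y _ => ?_) ((cost_pairLaw_left μ π hij hj ν ν').trans_lt h)
    ((cost_pairLaw_right μ π hij hi ν ν').trans_lt h')
  -- One output cannot equal two different sets.
  by_contra! hboth
  have : i ∈ insert j R := hboth.2 ▸ hboth.1 ▸ Finset.mem_insert_self i R
  exact (Finset.mem_insert.1 this).elim hij hi

/-- No test has an error exponent above the least Chernoff information. -/
theorem HasErrorExponent.le_minChernoff (hT : 0 < T) (hTM : T < M) {d : Rule Y M}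
    {μ : Fin M → Y → ℝ} {π : Y → ℝ} (hμ : ∀ i, FullPmf (μ i)) (hπ : FullPmf π) {a : ℝ}
    (h : HasErrorExponent T d μ π a) : a ≤ minChernoff μ π := by
  have : Nonempty {p : Fin M × Fin M // p.1 < p.2} :=
    ⟨⟨(⟨0, by omega⟩, ⟨1, by omega⟩), by simp⟩⟩
  refine le_ciInf fun p => le_of_forall_gt fun c hc => ?_
  obtain ⟨ν, ν', hν, hν', h1, h2⟩ := exists_pair_le_chernoff (hμ p.1.1) (hμ p.1.2) hπ
  obtain ⟨c', hc', hcc'⟩ := exists_between hc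
  exact (h.le (exp_le_maxError_of_pair hT hTM d hμ hπ p.2.ne hν hν' (h1.trans_lt hc')
    (h2.trans_lt hc'))).trans_lt hcc'

omit [DecidableEq Y] in
theorem minChernoff_nonneg {μ : Fin M → Y → ℝ} {π : Y → ℝ} (hμ : ∀ i, FullPmf (μ i))
    (hπ : FullPmf π) : 0 ≤ minChernoff μ π :=
  Real.iInf_nonneg fun p => chernoff_pair_nonneg (hμ p.1.1) (hμ p.1.2) hπ

omit [DecidableEq Y] in
theorem minChernoff_le (μ : Fin M → Y → ℝ) (π : Y → ℝ) {i j : Fin M} (hij : i < j) :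
    minChernoff μ π
      ≤ chernoff (fun z : Y × Y => μ i z.1 * π z.2) (fun z : Y × Y => π z.1 * μ j z.2) :=
  ciInf_le (f := fun p : {p : Fin M × Fin M // p.1 < p.2} =>
    chernoff (fun z : Y × Y => μ p.1.1 z.1 * π z.2) (fun z : Y × Y => π z.1 * μ p.1.2 z.2))
    (Set.finite_range _).bddBelow ⟨(i, j), hij⟩

end converse

/-! ### Bounds for fixed M and limits as M grows. -/

section final

variable {Y : Type*} [Fintype Y] {M T : ℕ}

theorem minBhatt_le (μ : Fin M → Y → ℝ) (q : Y → ℝ) (i : Fin M) :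
    minBhatt μ q ≤ 2 * bhatt (μ i) q :=
  ciInf_le (f := fun i => 2 * bhatt (μ i) q) (Set.finite_range _).bddBelow i

theorem exists_minBhatt_eq (hM : 0 < M) (μ : Fin M → Y → ℝ) (q : Y → ℝ) :
    ∃ i, minBhatt μ q = 2 * bhatt (μ i) q := by
  have : Nonempty (Fin M) := ⟨⟨0, hM⟩⟩
  obtain ⟨i, hi⟩ := exists_eq_ciInf_of_finite (f := fun i => 2 * bhatt (μ i) q)
  exact ⟨i, hi.symm⟩

/-- Equality would make μ a multiple of π, hence equal to it. This leaves room to move the geometric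
mean strictly closer to π. -/
theorem geoMean_ne_right {μ π : Y → ℝ} (hμ : FullPmf μ) (hπ : FullPmf π) (hne : μ ≠ π) :
    geoMean μ π ≠ π := by
  intro h
  have hZ := sum_sqrt_pos hμ hπ.mem
  set Z := ∑ y, √(μ y) * √(π y) with hZdef
  have key : ∀ y, μ y = Z ^ 2 * π y := by
    intro y
    have hy : √(μ y) * √(π y) = π y * Z := (div_eq_iff hZ.ne').1 (congrFun h y)
    have hs := Real.sqrt_pos.2 (hπ.pos y)
    have : √(μ y) = Z * √(π y) := by
      refine mul_right_cancel₀ hs.ne' ?_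
      rw [hy, mul_assoc, Real.mul_self_sqrt (hπ.pos y).le, mul_comm]
    rw [← Real.sq_sqrt (hμ.pos y).le, this, mul_pow, Real.sq_sqrt (hπ.pos y).le]
  have hone : Z ^ 2 = 1 := by
    have := hμ.mem.2
    rwa [Finset.sum_congr rfl fun y _ => key y, ← Finset.mul_sum, hπ.mem.2, mul_one] at this
  exact hne (funext fun y => by rw [key y, hone, one_mul])

/-- The least Bhattacharyya distance to a divergence ball is attained. -/
theorem exists_isLeast_minBhatt (hM : 0 < M) {μ : Fin M → Y → ℝ} {π : Y → ℝ}
    (hμ : ∀ i, FullPmf (μ i)) (hπ : FullPmf π) {r : ℝ} (hr : 0 ≤ r) :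
    ∃ m, IsLeast {x : ℝ | ∃ q ∈ stdSimplex ℝ Y, relEnt q π ≤ r ∧ x = minBhatt μ q} m := by
  have hC : IsCompact (stdSimplex ℝ Y ∩ {q | relEnt q π ≤ r}) :=
    (isCompact_stdSimplex ℝ Y).inter_right (isClosed_le (continuous_relEnt hπ) continuous_const)
  have hne : (stdSimplex ℝ Y ∩ {q | relEnt q π ≤ r}).Nonempty :=
    ⟨π, hπ.mem, (relEnt_self π).trans_le hr⟩
  -- The two minima are exchanged: each i is minimized over the ball, then the best i is chosen.
  have hmin : ∀ i, ∃ q ∈ stdSimplex ℝ Y ∩ {q | relEnt q π ≤ r},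
      IsMinOn (bhatt (μ i)) (stdSimplex ℝ Y ∩ {q | relEnt q π ≤ r}) q := by
    intro i
    refine hC.exists_isMinOn hne ?_
    have hs : Continuous fun q : Y → ℝ => ∑ y, √(μ i y) * √(q y) := by fun_prop
    exact (hs.continuousOn.log fun q hq => (sum_sqrt_pos (hμ i) hq.1).ne').neg
  choose g hg hgmin using hmin
  have : Nonempty (Fin M) := ⟨⟨0, hM⟩⟩
  obtain ⟨i₀, hi₀⟩ := Finite.exists_min fun i => bhatt (μ i) (g i)
  refine ⟨minBhatt μ (g i₀), ⟨g i₀, (hg i₀).1, (hg i₀).2, rfl⟩, ?_⟩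
  rintro x ⟨q, hq, hqr, rfl⟩
  obtain ⟨i, hi⟩ := exists_minBhatt_eq hM μ q
  have h1 : bhatt (μ i) (g i) ≤ bhatt (μ i) q := hgmin i ⟨hq, hqr⟩
  have h2 := minBhatt_le μ (g i₀) i₀
  have h3 := hi₀ i
  linarith

/-- At a point of confusion, the average outside the preferred set is close to `π`, and its
Bhattacharyya distances are bounded by the cost. -/
theorem Confusable.bound {μ : Fin M → Y → ℝ} {π : Y → ℝ} (hTM : T < M)
    (hμ : ∀ i, FullPmf (μ i)) (hπ : FullPmf π) {S S' : Finset (Fin M)} {γ : Fin M → Y → ℝ}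
    (h : Confusable T S S' γ) :
    avgOn S'ᶜ γ ∈ stdSimplex ℝ Y ∧
    ((M : ℝ) - T) * relEnt (avgOn S'ᶜ γ) π ≤ cost (law μ π S) γ + T * cConst π ∧
    minBhatt μ (avgOn S'ᶜ γ) ≤ cost (law μ π S) γ := by
  have hA := compl_nonempty_of_card hTM h.left
  have hA' := compl_nonempty_of_card hTM h.right
  have hq := avgOn_mem hA' h.mem
  have hD : ∀ i, 0 ≤ relEnt (γ i) π := fun i => relEnt_nonneg (h.mem i) hπ.mem (hπ.ac _)
  refine ⟨hq, ?_, ?_⟩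
  · have h1 := sum_relEnt_eq_jsd_add (A := S'ᶜ) hA' h.mem (r := π) fun i _ => hπ.ac _
    have h2 := jsd_nonneg hA' h.mem
    rw [card_compl_of_card h.right] at h1
    have h3 : ∑ k ∈ S'ᶜ, relEnt (γ k) π ≤ ∑ k ∈ S, relEnt (γ k) π + ∑ k ∈ Sᶜ, relEnt (γ k) π := by
      rw [Finset.sum_add_sum_compl]
      exact Finset.sum_le_univ_sum_of_nonneg hD
    have h4 : ∑ k ∈ S, relEnt (γ k) π ≤ T * cConst π := by
      rw [← h.left, ← nsmul_eq_mul]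
      exact Finset.sum_le_card_nsmul _ _ _ fun i _ => relEnt_le_cConst (h.mem i) hπ
    have h5 : ∑ k ∈ Sᶜ, relEnt (γ k) π ≤ cost (law μ π S) γ := by
      rw [cost_law]
      exact le_add_of_nonneg_left (Finset.sum_nonneg fun i _ =>
        relEnt_nonneg (h.mem i) (hμ i).mem ((hμ i).ac _))
    linarith
  · obtain ⟨i, hi⟩ := sdiff_nonempty_of_card h.left h.right h.ne
    rw [Finset.mem_sdiff] at hi
    have hi' : i ∈ S'ᶜ := Finset.mem_compl.2 hi.2
    have h1 := minBhatt_le μ (avgOn S'ᶜ γ) i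
    have h2 := two_bhatt_le (hμ i) hq (h.mem i) (avgOn_ac h.mem hi')
    have h3 := relEnt_le_jsd h.mem hi'
    have h4 := jsd_le_sum_relEnt hA h.mem hπ.mem fun i _ => hπ.ac _
    have h5 := add_sum_compl_le_cost (π := π) hμ h.mem hi.1
    have h6 := h.le
    linarith

variable [DecidableEq Y]

/-- The universal test: lower bounds on its error exponent. -/
theorem exists_univ_lower {μ : Fin M → Y → ℝ} {π : Y → ℝ} (hT : 0 < T)
    (hTM : 2 * T < M) (hμ : ∀ i, FullPmf (μ i)) (hπ : FullPmf π) (hne : ∀ i, μ i ≠ π)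
    {d : Rule Y M} (hd : IsUnivTest T d) :
    ∃ a, HasErrorExponent T d μ π a ∧ a ≤ minBhatt μ π ∧ ∃ q ∈ stdSimplex ℝ Y,
      relEnt q π ≤ 1 / ((M : ℝ) - T) * (minChernoff μ π + T * cConst π) ∧ minBhatt μ q ≤ a := by
  have hTM' : T < M := by omega
  obtain ⟨S, S', γ, hc, hmin, ha⟩ := exists_hasErrorExponent_univ hT hTM hμ hπ hne hd
  refine ⟨_, ha, ?_, ?_⟩
  · obtain ⟨i, hi⟩ := exists_minBhatt_eq (by omega) μ π
    obtain ⟨j, hij⟩ : ∃ j : Fin M, i ≠ j := by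
      have : Nontrivial (Fin M) := Fin.nontrivial_iff_two_le.2 (by omega)
      obtain ⟨j, hj⟩ := exists_ne i
      exact ⟨j, hj.symm⟩
    obtain ⟨R, hiR, hjR, hci, hcj⟩ := exists_swap hT hTM' hij
    -- The same law on coordinates i and j makes the two sets tie, at cost exactly 2B(μ_i, π).
    have hν := geoMean_full (hμ i) hπ
    have hconf : Confusable T (insert i R) (insert j R)
        (pairLaw μ π R i j (geoMean (μ i) π) (geoMean (μ i) π)) :=
      ⟨hci, hcj, fun h => (Finset.mem_insert.1 (h ▸ Finset.mem_insert_self i R :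
        i ∈ insert j R)).elim hij hiR, fun k => (pairLaw_full hμ hπ R i j hν hν k).mem,
        (jsd_insert_eq hjR hiR (by rw [pairLaw_left, pairLaw_right _ _ _ hij])).le⟩
    refine (hmin _ _ _ hconf).trans ?_
    rw [cost_pairLaw_left μ π hij hjR, relEnt_geoMean (hμ i) hπ, hi]
  · obtain ⟨hq, h1, h2⟩ := hc.bound hTM' hμ hπ
    refine ⟨_, hq, ?_, h2⟩
    have hpos : (0 : ℝ) < (M : ℝ) - T := sub_pos.2 (by exact_mod_cast hTM')
    rw [one_div, inv_mul_eq_div, le_div_iff₀ hpos, mul_comm]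
    linarith [ha.le_minChernoff hT hTM' hμ hπ]

/-- The error exponent of the test that knows the typical distribution. -/
theorem hasErrorExponent_typ {μ : Fin M → Y → ℝ} {π : Y → ℝ} (hT : 0 < T)
    (hTM : T < M) (hμ : ∀ i, FullPmf (μ i)) (hπ : FullPmf π) (hne : ∀ i, μ i ≠ π)
    {d : Rule Y M} (hd : IsTypTest T π d) : HasErrorExponent T d μ π (minBhatt μ π) := by
  have hM : 0 < M := by omega
  obtain ⟨i, hi⟩ := exists_minBhatt_eq hM μ π
  obtain ⟨j, hij⟩ : ∃ j : Fin M, i ≠ j := by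
    have : Nontrivial (Fin M) := Fin.nontrivial_iff_two_le.2 (by omega)
    obtain ⟨j, hj⟩ := exists_ne i
    exact ⟨j, hj.symm⟩
  obtain ⟨R, hiR, hjR, hci, hcj⟩ := exists_swap hT hTM hij
  refine hasErrorExponent_of_cost hμ hπ ⟨_, hci⟩ ?_ ?_
  · intro S hS n hn y hy
    have hmem : ∀ k, emp y k ∈ stdSimplex ℝ Y := fun k => empirical_mem hn (y k)
    obtain ⟨k, hk⟩ := sdiff_nonempty_of_card hS (hd n y).1 hy.symm
    rw [Finset.mem_sdiff] at hk
    have h1 := minBhatt_le μ π k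
    have h2 := two_bhatt_le (hμ k) hπ.mem (hmem k) (hπ.ac _)
    have h3 : relEnt (emp y k) π ≤ statTyp π y (d n y) :=
      Finset.single_le_sum (f := fun k => relEnt (emp y k) π)
        (fun l _ => relEnt_nonneg (hmem l) hπ.mem (hπ.ac _)) (Finset.mem_compl.2 hk.2)
    have h4 : statTyp π y (d n y) ≤ ∑ k ∈ Sᶜ, relEnt (emp y k) π := (hd n y).2 S hS
    have h5 := add_sum_compl_le_cost (π := π) hμ hmem hk.1
    linarith
  · intro c hc
    set ν := geoMean (μ i) π with hνdef
    have hν : FullPmf ν := geoMean_full (hμ i) hπ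
    have hνπ : 0 < relEnt ν π :=
      relEnt_pos hν.mem hπ.mem (hπ.ac _) (geoMean_ne_right (hμ i) hπ (hne i))
    -- Two coordinates at ν would only tie. Moving the true outlier i slightly towards π makes the
    -- test strictly prefer j, at cost still below `c`.
    set f : ℝ → Y → ℝ := fun t => (1 - t) • ν + t • π with hf
    have hfc : Continuous f := by fun_prop
    have hf0 : f 0 = ν := by simp [hf]
    have hV : {τ : Y → ℝ | relEnt τ (μ i) + relEnt ν π < c} ∈ 𝓝 (f 0) := by
      refine (isOpen_lt ((continuous_relEnt (hμ i)).add continuous_const)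
        continuous_const).mem_nhds ?_
      change relEnt (f 0) (μ i) + relEnt ν π < c
      rw [hf0, hνdef, relEnt_geoMean (hμ i) hπ, ← hi]
      exact hc
    obtain ⟨t, ht0, ht1, htV⟩ := exists_mem_Ioc_of_continuous hfc hV
    have hft : FullPmf (f t) := mix_full hν.mem hπ ht0 ht1
    have hlt : relEnt (f t) π < relEnt ν π := by
      refine (relEnt_mix_le hν.mem hπ.mem (hπ.ac _) ht0.le ht1).trans_lt ?_
      nlinarith
    have hcost : cost (law μ π (insert i R)) (pairLaw μ π R i j (f t) ν) < c := by
      rw [cost_pairLaw_left μ π hij hjR]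
      exact htV
    have hopen : IsOpen {τ : Fin M → Y → ℝ | ∑ k ∈ (insert j R)ᶜ, relEnt (τ k) π
        < ∑ k ∈ (insert i R)ᶜ, relEnt (τ k) π} :=
      isOpen_lt
        (continuous_finsetSum _ fun k _ => (continuous_relEnt hπ).comp (continuous_apply k))
        (continuous_finsetSum _ fun k _ => (continuous_relEnt hπ).comp (continuous_apply k))
    refine exp_le_maxError d hμ hπ hci hci (pairLaw_full hμ hπ R i j hft hν)
      (hopen.mem_nhds ?_) (fun n hn y hy => or_self_iff.2 fun h => ?_) hcost hcost
    · rw [Set.mem_ofPred_eq, sum_compl_insert hiR, sum_compl_insert hjR, pairLaw_left,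
        pairLaw_right _ _ _ hij]
      linarith
    · have h1 := (hd n y).2 _ hcj
      rw [h] at h1
      exact absurd hy (not_lt.2 h1)

omit [DecidableEq Y] in
theorem bhatt_nonneg {μ q : Y → ℝ} (hμ : FullPmf μ) (hq : FullPmf q) : 0 ≤ bhatt μ q := by
  have hg := geoMean_full hμ hq
  have h1 := relEnt_nonneg hg.mem hμ.mem (hμ.ac _)
  have h2 := relEnt_nonneg hg.mem hq.mem (hq.ac _)
  have h3 := relEnt_geoMean hμ hq
  linarith

section sequences

variable {μ : ℕ → Y → ℝ} {π : Y → ℝ}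

omit [DecidableEq Y] in
theorem bddBelow_bhatt (hμ : ∀ i, FullPmf (μ i)) (hπ : FullPmf π) :
    BddBelow (Set.range fun i => 2 * bhatt (μ i) π) :=
  ⟨0, by rintro _ ⟨i, rfl⟩; linarith [bhatt_nonneg (hμ i) hπ]⟩

omit [DecidableEq Y] in
theorem tendsto_minBhatt (hμ : ∀ i, FullPmf (μ i)) (hπ : FullPmf π) :
    Tendsto (fun M : ℕ => minBhatt (firstM μ M) π) atTop (𝓝 (⨅ i, 2 * bhatt (μ i) π)) := by
  have hb := bddBelow_bhatt hμ hπ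
  rw [tendsto_order]
  constructor
  · intro b hlt
    filter_upwards [eventually_gt_atTop 0] with M hM
    obtain ⟨i, hi⟩ := exists_minBhatt_eq hM (firstM μ M) π
    rw [hi]
    exact hlt.trans_le (ciInf_le hb (i : ℕ))
  · intro b hlt
    obtain ⟨i, hi⟩ := exists_lt_of_ciInf_lt hlt
    filter_upwards [eventually_gt_atTop i] with M hM
    exact (minBhatt_le (firstM μ M) π ⟨i, hM⟩).trans_lt hi

/-- A squeeze: the exponent is at most the minimum at π and at least the minimum at some q with
D(q‖π) = O(1/M). -/
theorem tendsto_univ (hT : 0 < T) (hμ : ∀ i, FullPmf (μ i)) (hπ : FullPmf π)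
    (hne : ∀ i, μ i ≠ π) {δ : ∀ M : ℕ, Rule Y M} (hδ : ∀ M, 2 * T < M → IsUnivTest T (δ M)) :
    ∃ α : ℕ → ℝ, (∀ M, 2 * T < M → HasErrorExponent T (δ M) (firstM μ M) π (α M)) ∧
      Tendsto α atTop (𝓝 (⨅ i, 2 * bhatt (μ i) π)) := by
  have hex := fun M (hM : 2 * T < M) => exists_univ_lower hT hM (μ := firstM μ M)
    (fun i => hμ i) hπ (fun i => hne i) (hδ M hM)
  choose! α hα hup q hq hqD hlow using hex
  refine ⟨α, hα, ?_⟩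
  -- The pair (0, 1) bounds the least Chernoff information by a constant independent of M.
  set K := chernoff (fun z : Y × Y => μ 0 z.1 * π z.2) (fun z : Y × Y => π z.1 * μ 1 z.2)
    + T * cConst π with hK
  have hr : Tendsto (fun M : ℕ => K / ((M : ℝ) - T)) atTop (𝓝 0) :=
    tendsto_const_nhds.div_atTop
      (tendsto_atTop_add_const_right _ (-(T : ℝ)) tendsto_natCast_atTop_atTop)
  have herr : Tendsto (fun M : ℕ => 2 * (√(K / ((M : ℝ) - T)) * Real.exp (cConst π / 2)))
      atTop (𝓝 0) := by
    have := ((Real.continuous_sqrt.tendsto 0).comp hr).mul_const (Real.exp (cConst π / 2))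
    simpa using this.const_mul 2
  have hm := tendsto_minBhatt hμ hπ
  have hl := hm.sub herr
  rw [sub_zero] at hl
  refine tendsto_of_tendsto_of_tendsto_of_le_of_le' hl hm ?_ ?_
  · filter_upwards [eventually_gt_atTop (2 * T)] with M hM
    refine le_trans ?_ (hlow M hM)
    obtain ⟨i, hi⟩ := exists_minBhatt_eq (by omega) (firstM μ M) (q M)
    have h1 := minBhatt_le (firstM μ M) π i
    have h2 := bhatt_sub_le (hμ i) hπ (hq M hM)
    have hpos : (0 : ℝ) < (M : ℝ) - T := sub_pos.2 (by exact_mod_cast (by omega : T < M))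
    have h3 : relEnt (q M) π ≤ K / ((M : ℝ) - T) := by
      refine (hqD M hM).trans ?_
      rw [one_div, inv_mul_eq_div]
      have := minChernoff_le (firstM μ M) π (i := ⟨0, by omega⟩) (j := ⟨1, by omega⟩) (by simp)
      gcongr
      rw [hK]
      gcongr
      exact this
    have h4 : √(relEnt (q M) π) * Real.exp (cConst π / 2)
        ≤ √(K / ((M : ℝ) - T)) * Real.exp (cConst π / 2) := by gcongr
    rw [hi]
    simp only [firstM] at h1 ⊢
    linarith
  · filter_upwards [eventually_gt_atTop (2 * T)] with M hM
    exact hup M hM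

omit [DecidableEq Y] in
/-- If the outlier distributions accumulate at `π`, so do pairs of them in Chernoff
information. -/
theorem tendsto_minChernoff_zero (hμ : ∀ i, FullPmf (μ i)) (hπ : FullPmf π)
    (hne : ∀ i, μ i ≠ π) (h0 : ⨅ i, 2 * bhatt (μ i) π = 0) :
    Tendsto (fun M : ℕ => minChernoff (firstM μ M) π) atTop (𝓝 0) := by
  rw [tendsto_order]
  refine ⟨fun b hb => Eventually.of_forall fun M =>
    hb.trans_le (minChernoff_nonneg (fun i => hμ i) hπ), fun b hb => ?_⟩
  -- With κ = exp(-b/4), the bound -2 log κ is b/2 < b.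
  have hκ1 : Real.exp (-(b / 4)) < 1 := Real.exp_lt_one_iff.2 (by linarith)
  obtain ⟨ε, hε, hclose⟩ := exists_bhatt_lt_imp_le hπ (Real.exp_pos (-(b / 4))) hκ1
  have hsmall : ∀ e > 0, ∃ i, bhatt (μ i) π < e := by
    intro e he
    obtain ⟨i, hi⟩ := exists_lt_of_ciInf_lt (h0.trans_lt (by linarith : 0 < 2 * e))
    exact ⟨i, by linarith⟩
  obtain ⟨i, hi⟩ := hsmall ε hε
  -- Asking for a distance strictly below the positive one of i forces a second index.
  obtain ⟨j, hj⟩ := hsmall _ (bhatt_pos (hμ i) hπ (hne i))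
  have hij : i ≠ j := by
    rintro rfl
    exact hj.false
  have main : ∀ k l : ℕ, k < l → bhatt (μ k) π < ε → bhatt (μ l) π < ε →
      ∀ᶠ M : ℕ in atTop, minChernoff (firstM μ M) π < b := by
    intro k l hkl hk hl
    filter_upwards [eventually_gt_atTop l] with M hM
    have h1 := minChernoff_le (firstM μ M) π (i := ⟨k, hkl.trans hM⟩) (j := ⟨l, hM⟩) hkl
    have h2 := chernoff_pair_le (hμ k) (hμ l) hπ (Real.exp_pos (-(b / 4))) hκ1.le
      (hclose _ (hμ k) hk) (hclose _ (hμ l) hl)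
    rw [Real.log_exp] at h2
    refine (h1.trans h2).trans_lt ?_
    linarith
  rcases hij.lt_or_gt with h | h
  · exact main i j h hi (hj.trans hi)
  · exact main j i h (hj.trans hi) hi

end sequences

end final

end OutlierTest

/-! ### Assembly of the four claims. -/

open OutlierTest
theorem theorem10 {Y : Type*} [Fintype Y] [DecidableEq Y] (T : ℕ) (hT : 1 < T)
    (δ : ∀ M : ℕ, Rule Y M) (hδ : ∀ M, 2 * T < M → IsUnivTest T (δ M)) :
    -- the lower bound on the error exponent, for every fixed number of coordinates
    (∀ (M : ℕ), 2 * T < M → ∀ (μ : Fin M → Y → ℝ) (π : Y → ℝ),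
      (∀ i, FullPmf (μ i)) → FullPmf π → (∀ i, μ i ≠ π) →
      ∃ a m : ℝ, HasErrorExponent T (δ M) μ π a ∧
        IsLeast {x : ℝ | ∃ q ∈ stdSimplex ℝ Y,
          relEnt q π ≤ 1 / ((M : ℝ) - T) * (minChernoff μ π + T * cConst π) ∧
          x = minBhatt μ q} m ∧
        m ≤ a) ∧
    -- universally asymptotically exponential consistency
    UnivAsympExpConsistent T δ ∧
    -- the limiting exponent, shared by the test that knows the typical distribution
    (∀ (μ : ℕ → Y → ℝ) (π : Y → ℝ),
      (∀ i, FullPmf (μ i)) → FullPmf π → (∀ i, μ i ≠ π) →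
      ∃ L : ℝ, Tendsto (fun M : ℕ => minBhatt (firstM μ M) π) atTop (𝓝 L) ∧
        (∃ α : ℕ → ℝ,
          (∀ M, 2 * T < M → HasErrorExponent T (δ M) (firstM μ M) π (α M)) ∧
          Tendsto α atTop (𝓝 L)) ∧
        (∀ δ' : ∀ M : ℕ, Rule Y M, (∀ M, 2 * T < M → IsTypTest T π (δ' M)) →
          ∃ β : ℕ → ℝ,
            (∀ M, 2 * T < M → HasErrorExponent T (δ' M) (firstM μ M) π (β M)) ∧
            Tendsto β atTop (𝓝 L))) ∧
    -- asymptotic efficiency for identically distributed outliers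
    (∀ (μ π : Y → ℝ), FullPmf μ → FullPmf π → μ ≠ π →
      (∃ α : ℕ → ℝ,
        (∀ M, 2 * T < M → HasErrorExponent T (δ M) (fun _ => μ) π (α M)) ∧
        Tendsto α atTop (𝓝 (2 * bhatt μ π))) ∧
      (∀ M, 2 * T < M → ∀ (d : Rule Y M) (ε : ℝ), 0 < ε →
        ∀ᶠ n : ℕ in atTop, 0 < maxError T d (fun _ => μ) π n ∧
          -(1 / (n : ℝ)) * Real.log (maxError T d (fun _ => μ) π n) ≤ 2 * bhatt μ π + ε)) := by

  have hT0 : 0 < T := by omega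
  have h3 : ∀ (μ : ℕ → Y → ℝ) (π : Y → ℝ), (∀ i, FullPmf (μ i)) → FullPmf π → (∀ i, μ i ≠ π) →
      ∃ α : ℕ → ℝ, (∀ M, 2 * T < M → HasErrorExponent T (δ M) (firstM μ M) π (α M)) ∧
        Tendsto α atTop (𝓝 (⨅ i, 2 * bhatt (μ i) π)) := fun μ π hμ hπ hne =>
    tendsto_univ hT0 hμ hπ hne hδ
  refine ⟨?_, ?_, ?_, ?_⟩
  · intro M hM μ π hμ hπ hne
    obtain ⟨a, ha, -, q, hq, hqD, hqa⟩ := exists_univ_lower hT0 hM hμ hπ hne (hδ M hM)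
    -- A nonnegative radius puts π in the ball, so the minimum is over a nonempty set.
    have hr : 0 ≤ 1 / ((M : ℝ) - T) * (minChernoff μ π + T * cConst π) := by
      have h1 : (0 : ℝ) < (M : ℝ) - T := sub_pos.2 (by exact_mod_cast (by omega : T < M))
      have h2 := minChernoff_nonneg hμ hπ
      have h4 := cConst_nonneg hπ
      positivity
    obtain ⟨m, hm⟩ := exists_isLeast_minBhatt (by omega) hμ hπ hr
    exact ⟨a, m, ha, hm, (hm.2 ⟨q, hq, hqD, rfl⟩).trans hqa⟩
  · intro μ π hμ hπ hne hnot
    obtain ⟨α, hα, hlim⟩ := h3 μ π hμ hπ hne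
    -- A zero limit would force the least Chernoff information to tend to 0, contrary to assumption.
    refine ⟨α, _, hα, hlim, lt_of_le_of_ne (le_ciInf fun i => ?_) fun h =>
      hnot (tendsto_minChernoff_zero hμ hπ hne h.symm)⟩
    linarith [bhatt_pos (hμ i) hπ (hne i)]
  · intro μ π hμ hπ hne
    refine ⟨_, tendsto_minBhatt hμ hπ, h3 μ π hμ hπ hne, fun δ' hδ' => ⟨_, fun M hM => ?_,
      tendsto_minBhatt hμ hπ⟩⟩
    exact hasErrorExponent_typ hT0 (by omega) (fun i => hμ i) hπ (fun i => hne i) (hδ' M hM)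
  · intro μ π hμ hπ hne
    constructor
    · have := h3 (fun _ => μ) π (fun _ => hμ) hπ fun _ => hne
      rwa [ciInf_const] at this
    · intro M hM d ε hε
      have hν := geoMean_full hμ hπ
      have hB := relEnt_geoMean hμ hπ
      -- With identical outlier laws, the geometric mean on both coordinates costs 2B(μ, π) under
      -- either hypothesis, so the converse reaches this value for every test.
      have hev := exp_le_maxError_of_pair hT0 (by omega) d (μ := fun _ : Fin M => μ)
        (fun _ => hμ) hπ (i := ⟨0, by omega⟩) (j := ⟨1, by omega⟩) (by simp) hν hν
        (c := 2 * bhatt μ π + ε) (by linarith) (by linarith)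
      filter_upwards [eventually_gt_atTop 0, hev] with n hn h
      have hn' : (0 : ℝ) < n := by exact_mod_cast hn
      refine ⟨(Real.exp_pos _).trans_le h, ?_⟩
      have h4 := Real.log_le_log (Real.exp_pos _) h
      rw [Real.log_exp] at h4
      rw [neg_mul, one_div, ← div_eq_inv_mul, neg_le, le_div_iff₀ hn']
      linarith
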